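/- Let $G=(V,E)$ be a finite, connected, undirected, simple, unweighted graph with $n$ vertices, let $\{a,b\}\in E$, and let $x_1,\dots,x_{n-2}$ be an arbitrary ordering of $V\setminus\{a,b\}$. Consider the following variant of Wilson's algorithm. Start with two trees, $T_1$ consisting of the single vertex $a$ and $T_2$ consisting of the single vertex $b$. For $i=1,\dots,n-2$, run a simple random walk on $G$ from $x_i$ (from each vertex, the next vertex is a uniformly random neighbour), independent of the walks of the other iterations, until the first time (possibly time $0$) at which it is at a vertex of $T_1$ or $T_2$; let $P$ be the resulting path, and add the (chronological) loop erasure of $P$ to the tree, $T_1$ or $T_2$, that was hit by $P$. Finally return $T=T_1\cup T_2\cup\{a,b\}$. Then the algorithm terminates almost surely, and its output $T$ is uniformly distributed on the set of all spanning trees of $G$ that contain the edge $\{a,b\}$. -/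

import Mathlib

open MeasureTheory ProbabilityTheory
open scoped ENNReal

/-- Transition probability from `v` to `w` of the simple random walk on the unweighted graph `G`:
each neighbour of `v` is chosen with probability `1 / deg v`. -/
noncomputable def srwStep {V : Type*} [Fintype V] (G : SimpleGraph V) [DecidableRel G.Adj]
    (v w : V) : ℝ≥0∞ :=
  if G.Adj v w then (G.degree v : ℝ≥0∞)⁻¹ else 0

/-- The process `Y` is, under `μ`, a simple random walk on `G` started at `x`: it is the
time-homogeneous Markov chain with `Y 0 = x` almost surely and transition probabilities `srwStep G`.
The Markov property is written without division, as
`P(Y 0 = p 0, …, Y n = p n, Y (n + 1) = w) = P(Y 0 = p 0, …, Y n = p n) * srwStep G (p n) w`. -/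
structure IsSimpleRandomWalk {V : Type*} [Fintype V] [MeasurableSpace V]
    (G : SimpleGraph V) [DecidableRel G.Adj] (x : V)
    {Ω : Type*} [MeasurableSpace Ω] (Y : ℕ → Ω → V) (μ : Measure Ω) : Prop where
  measurable : ∀ t, Measurable (Y t)
  start : ∀ᵐ ω ∂μ, Y 0 ω = x
  step : ∀ (n : ℕ) (p : ℕ → V) (w : V),
    μ {ω | (∀ i ≤ n, Y i ω = p i) ∧ Y (n + 1) ω = w} =
      μ {ω | ∀ i ≤ n, Y i ω = p i} * srwStep G (p n) w

/-- Chronological loop erasure of a finite path `x₀, x₁, …`: keep `x₀`, jump to the last visit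
of `x₀`, and continue in the same way with the part of the path after that visit
(`l.rtakeWhile (· ≠ x)` is the part of `l` after the last occurrence of `x`). -/
def loopErasure {V : Type*} [DecidableEq V] : List V → List V
  | [] => []
  | x :: l => x :: loopErasure (l.rtakeWhile (fun y => decide (y ≠ x)))
termination_by l => l.length
decreasing_by
  exact Nat.lt_succ_of_le (List.rtakeWhile_suffix _ _).length_le

/-- The edges joining consecutive vertices of a path. -/
def pathEdges {V : Type*} [DecidableEq V] (l : List V) : Finset (Sym2 V) :=
  (List.zipWith (fun x y => s(x, y)) l l.tail).toFinset

/-- A tree under construction, given by its vertices and its edges. -/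
structure PartialTree (V : Type*) where
  verts : Finset V
  edges : Finset (Sym2 V)

/-- The tree that consists of the single vertex `x`. -/
def PartialTree.single {V : Type*} (x : V) : PartialTree V :=
  ⟨{x}, ∅⟩

/-- Add the vertices and the edges of the path `l` to the tree `T`. -/
def PartialTree.addPath {V : Type*} [DecidableEq V] (T : PartialTree V) (l : List V) :
    PartialTree V :=
  ⟨T.verts ∪ l.toFinset, T.edges ∪ pathEdges l⟩

open Classical in
/-- One iteration of the sampling algorithm, on the pair of trees `F = (T₁, T₂)` and with the
trajectory `y` of a walk: run the walk up to the first time at which it is in `T₁` or in `T₂`,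
and add the loop erasure of the path so obtained to the tree that was hit. The value is `none`
if the walk never hits `T₁` or `T₂`, that is, if the iteration does not terminate. -/
noncomputable def wilsonStep {V : Type*} [DecidableEq V] (F : PartialTree V × PartialTree V)
    (y : ℕ → V) : Option (PartialTree V × PartialTree V) :=
  if h : ∃ t, y t ∈ F.1.verts ∪ F.2.verts then
    let τ := Nat.find h
    let l := loopErasure ((List.range (τ + 1)).map y)
    if y τ ∈ F.1.verts then some (F.1.addPath l, F.2) else some (F.1, F.2.addPath l)
  else none

/-- The sampling algorithm for the edge `{a, b}`: start with the trees `T₁ = {a}` and `T₂ = {b}`,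
perform one iteration for each vertex `x` of the list `order` of the remaining vertices, in this
order, with the trajectory `y x` of a walk from `x`, and return `T₁ ∪ T₂ ∪ {a, b}`.
The value is `none` if one of the iterations does not terminate. -/
noncomputable def wilsonSampling {V : Type*} [DecidableEq V] (a b : V)
    (order : List {x : V // x ≠ a ∧ x ≠ b}) (y : {x : V // x ≠ a ∧ x ≠ b} → ℕ → V) :
    Option (SimpleGraph V) :=
  (order.foldlM (fun F x => wilsonStep F (y x))
      (PartialTree.single a, PartialTree.single b)).map
    fun F => SimpleGraph.fromEdgeSet ((F.1.edges : Set (Sym2 V)) ∪ F.2.edges ∪ {s(a, b)})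

/-- The spanning trees of `G` that contain the edge `{a, b}`. -/
def spanningTreesThrough {V : Type*} (G : SimpleGraph V) (a b : V) : Set (SimpleGraph V) :=
  {T | T ≤ G ∧ T.IsTree ∧ T.Adj a b}

/-!
Write `p` for the transition probabilities of the walk. Joining the two trees by the edge `{a, b}`
at the beginning instead of at the end does not change the output (`wilsonSampling_eq`), so that the
algorithm grows a single tree from `{a, b}`: each iteration adds the loop erasure of a walk stopped
on leaving the set `D` of the vertices not yet covered (`joinRun`).

Cutting a walk at the last visit of its starting point shows that its loop erasure is the path
`x₀, …, x_k` with probability `∏ G_i(x_i, x_i) p(x_i, x_{i+1})`, where `G_i` is Green's function of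
the walk killed outside `D \ {x₀, …, x_{i-1}}` (`exitSum_cons`). By Cramer's rule for the matrix
`1 - P` restricted to `D`, `G_D(x, x) = det (1 - P)_{D \ {x}} / det (1 - P)_D`
(`green_mul_greenDet`), so that the Green's functions multiply up to a ratio of determinants that
depends only on the sets of uncovered vertices before and after the iteration
(`exitSum_mul_greenDet`). The factors `p(x_i, x_{i+1})` are inverse degrees of the vertices that
the iteration covers.

Let `t` be a spanning tree of `G` containing `{a, b}`, rooted at `a`. The output is `t` precisely if
every iteration adds the path in `t` from its starting point towards the root. The iterations are
independent, and the ratios of determinants telescope: the probability of the output `t` is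
`(det (1 - P)_D)⁻¹ ∏_{v ∈ D} (deg v)⁻¹` with `D = V \ {a, b}`, whatever `t` is
(`measure_joinRun_eq`).

It remains to see that the output is almost surely a spanning tree through `{a, b}`. As `G` is
connected, the Green's functions are finite (`green_ne_top`), and the Borel–Cantelli lemma yields
that the walks almost surely reach the tree (`IsSimpleRandomWalk.ae_exists_notMem`). The output is
obtained from `{a, b}` by adding leaves along edges of `G`, hence is a tree
(`joinRun_mem_spanningTreesThrough`).
-/

/-! ### Words and their weights -/

section Words

variable {V : Type*}

/-- The weight of a finite word: the product of the transition weights `p` along its consecutive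
letters. The initial letter carries no weight. -/
noncomputable def wordWeight (p : V → V → ℝ≥0∞) : List V → ℝ≥0∞
  | [] => 1
  | [_] => 1
  | x :: y :: l => p x y * wordWeight p (y :: l)

/-- `w` is the path of a walk stopped when it leaves `D`: the last letter of `w` is outside `D`
and all the others are in `D`. -/
def IsExit (D : Finset V) : List V → Prop
  | [] => False
  | [z] => z ∉ D
  | x :: y :: l => x ∈ D ∧ IsExit D (y :: l)

theorem wordWeight_append_cons (p : V → V → ℝ≥0∞) (c : List V) (x : V) (t : List V) :
    wordWeight p (c ++ x :: t) = wordWeight p (c ++ [x]) * wordWeight p (x :: t) := by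
  induction c with
  | nil => simp [wordWeight]
  | cons u c ih =>
    cases c with
    | nil => simp [wordWeight]
    | cons v c =>
      simp only [List.cons_append, wordWeight] at ih ⊢
      rw [ih, mul_assoc]

theorem isExit_cons {D : Finset V} (x : V) {t : List V} (ht : t ≠ []) :
    IsExit D (x :: t) ↔ x ∈ D ∧ IsExit D t := by
  cases t with
  | nil => exact absurd rfl ht
  | cons y t => rfl

theorem IsExit.ne_nil {D : Finset V} {w : List V} (h : IsExit D w) : w ≠ [] := by
  rintro rfl; exact h

theorem isExit_append {D : Finset V} (c : List V) {t : List V} (ht : t ≠ []) :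
    IsExit D (c ++ t) ↔ (∀ v ∈ c, v ∈ D) ∧ IsExit D t := by
  induction c with
  | nil => simp
  | cons u c ih => rw [List.cons_append, isExit_cons _ (by simp [ht]), ih]; simp [and_assoc]

theorem isExit_iff {D : Finset V} {w : List V} :
    IsExit D w ↔ ∃ c z, w = c ++ [z] ∧ (∀ v ∈ c, v ∈ D) ∧ z ∉ D := by
  constructor
  · intro h
    obtain ⟨c, z, rfl⟩ := (List.eq_nil_or_concat w).resolve_left h.ne_nil
    rw [List.concat_eq_append] at h ⊢
    rw [isExit_append c (by simp)] at h
    exact ⟨c, z, rfl, h⟩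
  · rintro ⟨c, z, rfl, h⟩
    rw [isExit_append c (by simp)]
    exact h

theorem IsExit.eq_singleton {D : Finset V} {x : V} {t : List V} (h : IsExit D (x :: t))
    (hx : x ∉ D) : t = [] := by
  by_contra ht
  exact hx ((isExit_cons x ht).1 h).1

variable [DecidableEq V]

theorem isExit_erase {D : Finset V} {x : V} {t : List V} (hx : x ∉ t) :
    IsExit (D.erase x) t ↔ IsExit D t := by
  rw [isExit_iff, isExit_iff]
  refine exists_congr fun c => exists_congr fun z => and_congr_right fun h => ?_
  subst h
  have hz : z ≠ x := by rintro rfl; simp at hx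
  have hc : ∀ v ∈ c, v ≠ x := by rintro v hv rfl; simp [hv] at hx
  simp only [Finset.mem_erase, not_and, hz, ne_eq, not_false_eq_true, forall_const]
  refine and_congr_left fun _ => forall₂_congr fun v hv => ?_
  simp [hc v hv]

/-! ### Loop erasure -/

/-- A word is split at the last visit of its first letter; `loopErasure` continues with the part
after that visit. -/
theorem exists_lastVisit (x : V) (l : List V) :
    ∃ c, x :: l = c ++ x :: l.rtakeWhile (fun y => decide (y ≠ x)) ∧
      (c ++ [x]).head? = some x := by
  by_cases hx : x ∈ l
  · set t := l.rtakeWhile (fun y => decide (y ≠ x)) with ht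
    have h := List.rdropWhile_append_rtakeWhile (p := fun y => decide (y ≠ x)) (l := l)
    have hne : l.rdropWhile (fun y => decide (y ≠ x)) ≠ [] := by
      rw [Ne, List.rdropWhile_eq_nil_iff]
      intro h; simpa using h x hx
    have hl := List.rdropWhile_last_not (fun y => decide (y ≠ x)) l hne
    refine ⟨x :: (l.rdropWhile (fun y => decide (y ≠ x))).dropLast, ?_, by simp⟩
    have h2 := List.dropLast_append_getLast hne
    simp only [ne_eq, decide_not, Bool.not_eq_eq_eq_not, Bool.not_true, decide_eq_false_iff_not,
      not_not] at hl
    conv_lhs => rw [← h, ← h2]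
    simp [ht, hl]
  · refine ⟨[], ?_, by simp⟩
    rw [List.rtakeWhile_eq_self_iff.2]
    · simp
    · intro y hy; simp; rintro rfl; exact hx hy

theorem rtakeWhile_append_cons {x : V} (c : List V) {t : List V} (ht : x ∉ t) :
    (c ++ x :: t).rtakeWhile (fun y => decide (y ≠ x)) = t := by
  induction t using List.reverseRecOn with
  | nil => rw [List.rtakeWhile_concat]; simp
  | append_singleton t z ih =>
    have hz : z ≠ x := by rintro rfl; simp at ht
    have : c ++ x :: (t ++ [z]) = (c ++ x :: t) ++ [z] := by simp
    rw [this, List.rtakeWhile_concat, if_pos (by simpa using hz), ih (by simp_all)]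

theorem loopErasure_cons (x : V) (l : List V) : loopErasure (x :: l) =
    x :: loopErasure (l.rtakeWhile (fun y => decide (y ≠ x))) := by
  rw [loopErasure]

theorem loopErasure_append_cons {x : V} {c t : List V} (hc : (c ++ [x]).head? = some x)
    (ht : x ∉ t) : loopErasure (c ++ x :: t) = x :: loopErasure t := by
  cases c with
  | nil =>
    rw [List.nil_append, loopErasure_cons, List.rtakeWhile_eq_self_iff.2]
    intro y hy; simp; rintro rfl; exact ht hy
  | cons u c =>
    simp only [List.cons_append, List.head?_cons, Option.some.injEq] at hc
    subst hc
    rw [List.cons_append, loopErasure_cons, rtakeWhile_append_cons c ht]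

/-- Induction along the loop erasure: a word is either empty or of the form `c ++ x :: t` where
`c ++ [x]` is a closed word at `x` and `t` does not visit `x`. -/
theorem loopErasure_induction {P : List V → Prop} (nil : P [])
    (step : ∀ c x t, (c ++ [x]).head? = some x → x ∉ t → P t → P (c ++ x :: t)) (w : List V) :
    P w := by
  induction hn : w.length using Nat.strong_induction_on generalizing w with
  | _ n ih =>
    cases w with
    | nil => exact nil
    | cons x l =>
      obtain ⟨c, hc, hx⟩ := exists_lastVisit x l
      rw [hc]
      refine step c x _ hx (fun h => by simpa using List.mem_rtakeWhile_imp h) (ih _ ?_ _ rfl)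
      rw [← hn]
      exact Nat.lt_succ_of_le (List.rtakeWhile_suffix _ _).length_le

theorem head?_loopErasure (w : List V) : (loopErasure w).head? = w.head? := by
  cases w with
  | nil => simp [loopErasure]
  | cons x l => simp [loopErasure_cons]

theorem loopErasure_eq_nil {w : List V} : loopErasure w = [] ↔ w = [] := by
  rw [← List.head?_eq_none_iff, head?_loopErasure, List.head?_eq_none_iff]

theorem getLast?_loopErasure (w : List V) : (loopErasure w).getLast? = w.getLast? := by
  induction w using loopErasure_induction with
  | nil => simp [loopErasure]
  | step c x t hc hx ih =>
    rw [loopErasure_append_cons hc hx]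
    simp [List.getLast?_append, List.getLast?_cons, ih]

theorem loopErasure_subset (w : List V) : loopErasure w ⊆ w := by
  induction w using loopErasure_induction with
  | nil => simp [loopErasure]
  | step c x t hc hx ih =>
    rw [loopErasure_append_cons hc hx]
    intro v hv
    rcases List.mem_cons.1 hv with rfl | hv
    · simp
    · simp [ih hv]

theorem nodup_loopErasure (w : List V) : (loopErasure w).Nodup := by
  induction w using loopErasure_induction with
  | nil => simp [loopErasure]
  | step c x t hc hx ih =>
    rw [loopErasure_append_cons hc hx, List.nodup_cons]
    exact ⟨fun h => hx (loopErasure_subset t h), ih⟩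

theorem isChain_loopErasure {R : V → V → Prop} {w : List V} (h : w.IsChain R) :
    (loopErasure w).IsChain R := by
  induction w using loopErasure_induction with
  | nil => simp [loopErasure]
  | step c x t hc hx ih =>
    rw [loopErasure_append_cons hc hx]
    have h' := (List.isChain_append.1 h).2.1
    rw [List.isChain_cons] at h' ⊢
    rw [head?_loopErasure]
    exact ⟨h'.1, ih h'.2⟩

theorem IsExit.loopErasure {D : Finset V} {w : List V} (h : IsExit D w) :
    IsExit D (loopErasure w) := by
  induction w using loopErasure_induction with
  | nil => exact h.elim
  | step c x t hc hx ih =>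
    rw [loopErasure_append_cons hc hx]
    have h' := ((isExit_append c (by simp)).1 h).2
    by_cases ht : t = []
    · subst ht; simpa [_root_.loopErasure] using h'
    · rw [isExit_cons _ ht] at h'
      rw [isExit_cons _ (by rwa [Ne, loopErasure_eq_nil])]
      exact ⟨h'.1, ih h'.2⟩

/-! ### Green's function and the weight of a loop-erased path -/

open Classical in
/-- Green's function of the chain `p` killed outside `D`, for `z ∈ D`: the total weight of the
words from `x` to `z` all of whose letters except possibly the last one are in `D`. -/
noncomputable def green (p : V → V → ℝ≥0∞) (D : Finset V) (x z : V) : ℝ≥0∞ :=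
  ∑' c : List V, if (∀ v ∈ c, v ∈ D) ∧ (c ++ [z]).head? = some x
    then wordWeight p (c ++ [z]) else 0

open Classical in
/-- The total weight of the words that stop on leaving `D` and have loop erasure `γ`. -/
noncomputable def exitSum (p : V → V → ℝ≥0∞) (D : Finset V) (γ : List V) : ℝ≥0∞ :=
  ∑' w : List V, if IsExit D w ∧ loopErasure w = γ then wordWeight p w else 0

theorem exitSum_singleton (p : V → V → ℝ≥0∞) {D : Finset V} {z : V} (hz : z ∉ D) :
    exitSum p D [z] = 1 := by
  classical
  rw [exitSum, tsum_eq_single [z]]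
  · rw [if_pos ⟨hz, by simp [loopErasure]⟩, wordWeight]
  · intro w hw
    rw [if_neg]
    rintro ⟨he, hl⟩
    apply hw
    cases w with
    | nil => exact he.elim
    | cons x l =>
      rw [loopErasure_cons, List.cons.injEq] at hl
      obtain ⟨rfl, -⟩ := hl
      rw [he.eq_singleton hz]

/-- Cutting at the last visit of the starting point: a word with loop erasure `x :: y :: r` is a
closed word at `x` inside `D`, followed by a step to `y` and by a word that leaves `D \ {x}` and has
loop erasure `y :: r`. -/
theorem exitSum_cons (p : V → V → ℝ≥0∞) {D : Finset V} {x y : V} {r : List V} (hx : x ∈ D)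
    (hr : x ∉ y :: r) :
    exitSum p D (x :: y :: r) = green p D x x * (p x y * exitSum p (D.erase x) (y :: r)) := by
  classical
  rw [exitSum, green, exitSum, ← ENNReal.tsum_mul_left, ← ENNReal.tsum_mul_right]
  simp_rw [← ENNReal.tsum_mul_left]
  rw [← ENNReal.tsum_prod (f := fun c t : List V =>
    (if (∀ v ∈ c, v ∈ D) ∧ (c ++ [x]).head? = some x then wordWeight p (c ++ [x]) else 0) *
      (p x y * if IsExit (D.erase x) t ∧ loopErasure t = y :: r then wordWeight p t else 0))]
  have key : ∀ c t : List V, (∀ v ∈ c, v ∈ D) → (c ++ [x]).head? = some x →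
      IsExit (D.erase x) t → loopErasure t = y :: r → x ∉ t ∧ IsExit D (c ++ x :: t) ∧
        loopErasure (c ++ x :: t) = x :: y :: r ∧
        wordWeight p (c ++ x :: t) = wordWeight p (c ++ [x]) * (p x y * wordWeight p t) := by
    intro c t hc hcx ht hl
    -- the last letter of `t` is the last letter of `y :: r`, hence is not `x`
    have hxt : x ∉ t := by
      obtain ⟨s, z, rfl, hs, hz⟩ := isExit_iff.1 ht
      intro hm
      rcases List.mem_append.1 hm with h | h
      · simpa using hs x h
      · have : (y :: r).getLast? = some x := by
          rw [← hl, getLast?_loopErasure]; simpa using (List.mem_singleton.1 h).symm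
        exact hr (List.mem_of_getLast? this)
    have h2 : t.head? = some y := by rw [← head?_loopErasure, hl]; rfl
    refine ⟨hxt, ?_, ?_, ?_⟩
    · rw [isExit_append _ (by simp), isExit_cons _ ht.ne_nil]
      exact ⟨hc, hx, (isExit_erase hxt).1 ht⟩
    · rw [loopErasure_append_cons hcx hxt, hl]
    · rw [wordWeight_append_cons]
      cases t with
      | nil => simp at h2
      | cons u t =>
        obtain rfl : u = y := by simpa using h2
        rw [wordWeight]
  refine tsum_eq_tsum_of_ne_zero_bij (fun q => q.1.1 ++ x :: q.1.2) ?_ ?_ ?_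
  · rintro ⟨⟨c, t⟩, h⟩ ⟨⟨c', t'⟩, h'⟩ he
    simp only [Function.mem_support, ne_eq, mul_eq_zero, ite_eq_right_iff, not_or, not_forall,
      exists_prop] at h h'
    have k := (key c t h.1.1.1 h.1.1.2 h.2.2.1.1 h.2.2.1.2).1
    have k' := (key c' t' h'.1.1.1 h'.1.1.2 h'.2.2.1.1 h'.2.2.1.2).1
    have ht : t = t' := by
      rw [← rtakeWhile_append_cons c k, ← rtakeWhile_append_cons c' k']
      exact congrArg _ he
    subst ht
    have := List.append_cancel_right he
    subst this; rfl
  · intro w hw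
    simp only [Function.mem_support, ne_eq, ite_eq_right_iff, not_forall, exists_prop] at hw
    obtain ⟨⟨he, hl⟩, hw0⟩ := hw
    cases w with
    | nil => exact he.elim
    | cons x' l =>
      obtain ⟨c, hc, hcx⟩ := exists_lastVisit x' l
      rw [loopErasure_cons, List.cons.injEq] at hl
      obtain ⟨rfl, hl⟩ := hl
      set t := l.rtakeWhile (fun y => decide (y ≠ x')) with htdef
      have hxt : x' ∉ t := fun h => by simpa using List.mem_rtakeWhile_imp h
      have htne : t ≠ [] := by rw [Ne, ← loopErasure_eq_nil, hl]; simp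
      rw [hc, isExit_append _ (by simp), isExit_cons _ htne] at he
      have h1 := (isExit_erase hxt).2 he.2.2
      have h2 := key c t he.1 hcx h1 hl
      refine ⟨⟨(c, t), ?_⟩, hc.symm⟩
      rw [Function.mem_support]
      dsimp only
      rw [if_pos ⟨he.1, hcx⟩, if_pos ⟨h1, hl⟩, ← h2.2.2.2, ← hc]
      exact hw0
  · rintro ⟨⟨c, t⟩, h⟩
    simp only [Function.mem_support, ne_eq, mul_eq_zero, ite_eq_right_iff, not_or, not_forall,
      exists_prop] at h
    obtain ⟨-, h1, h2, h3⟩ := key c t h.1.1.1 h.1.1.2 h.2.2.1.1 h.2.2.1.2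
    dsimp only
    rw [if_pos ⟨h1, h2⟩, if_pos h.1.1, if_pos h.2.2.1, h3]

theorem green_of_notMem (p : V → V → ℝ≥0∞) {D : Finset V} {x z : V} (hx : x ∉ D) (hz : z ∈ D) :
    green p D x z = 0 := by
  classical
  rw [green, ENNReal.tsum_eq_zero]
  intro c
  rw [if_neg]
  rintro ⟨hc, h⟩
  cases c with
  | nil =>
    obtain rfl : z = x := by simpa using h
    exact hx hz
  | cons u c =>
    obtain rfl : u = x := by simpa using h
    exact hx (hc u (by simp))

end Words

/-! ### Green's function and determinants -/

section Determinant

variable {V : Type*} [DecidableEq V]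

/-- First-step decomposition of Green's function. -/
theorem green_of_mem (p : V → V → ℝ≥0∞) [Fintype V] {D : Finset V} {x z : V} (hx : x ∈ D) :
    green p D x z = (if x = z then 1 else 0) + ∑ y, p x y * green p D y z := by
  classical
  have e : green p D x z = (if x = z then 1 else 0) + ∑' q : V × List V,
      (if (∀ v ∈ q.1 :: q.2, v ∈ D) ∧ ((q.1 :: q.2) ++ [z]).head? = some x
        then wordWeight p ((q.1 :: q.2) ++ [z]) else 0) := by
    let f : List V → ℝ≥0∞ := fun c => if (∀ v ∈ c, v ∈ D) ∧ (c ++ [z]).head? = some x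
      then wordWeight p (c ++ [z]) else 0
    have hinj : Function.Injective (fun q : V × List V => q.1 :: q.2) := by
      rintro ⟨a, b⟩ ⟨a', b'⟩ h
      simpa using h
    have h0 : green p D x z = ∑' c, f c :=
      tsum_congr fun c => by simp only [f]; congr
    rw [h0, ENNReal.tsum_eq_add_tsum_ite []]
    congr 1
    · simp [f, wordWeight, eq_comm]
    · rw [← hinj.tsum_eq]
      · exact tsum_congr fun q => if_neg (by simp)
      · intro c hc
        cases c with
        | nil => simp at hc
        | cons u c => exact ⟨(u, c), rfl⟩
  rw [e]
  congr 1
  have e2 : ∑' q : V × List V, (if (∀ v ∈ q.1 :: q.2, v ∈ D) ∧ ((q.1 :: q.2) ++ [z]).head? = some x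
        then wordWeight p ((q.1 :: q.2) ++ [z]) else 0) =
      ∑' c : List V, if ∀ v ∈ c, v ∈ D then wordWeight p (x :: (c ++ [z])) else 0 := by
    rw [ENNReal.tsum_prod (f := fun u c => if (∀ v ∈ u :: c, v ∈ D) ∧
      ((u :: c) ++ [z]).head? = some x then wordWeight p ((u :: c) ++ [z]) else 0),
      tsum_eq_single x]
    · refine tsum_congr fun c => ?_
      simp [hx]
    · intro u hu
      simp [hu]
  rw [e2]
  simp_rw [green, ← ENNReal.tsum_mul_left]
  rw [← Summable.tsum_finsetSum fun _ _ => ENNReal.summable]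
  refine tsum_congr fun c => ?_
  obtain ⟨u, t, ht⟩ : ∃ u t, c ++ [z] = u :: t := by
    cases c <;> simp
  rw [ht, Finset.sum_eq_single u]
  · by_cases hc : ∀ v ∈ c, v ∈ D <;> simp [hc, wordWeight]
  · intro v _ hv
    simp [Ne.symm hv]
  · simp

open Classical in
/-- If a word from `z` that leaves `D` has positive weight, then extending by it the words counted
by `green p D y z` embeds them in the words from `y` that leave `D`. -/
theorem green_ne_top (p : V → V → ℝ≥0∞) {D : Finset V} {y z : V} {t : List V}
    (ht : IsExit D (z :: t)) (hw : wordWeight p (z :: t) ≠ 0)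
    (hy : ∑' w : List V, (if IsExit D w ∧ w.head? = some y then wordWeight p w else 0) ≠ ∞) :
    green p D y z ≠ ∞ := by
  have h : green p D y z * wordWeight p (z :: t) ≤
      ∑' w : List V, (if IsExit D w ∧ w.head? = some y then wordWeight p w else 0) := by
    rw [green, ← ENNReal.tsum_mul_right]
    have hinj : Function.Injective (fun c : List V => c ++ z :: t) :=
      fun c c' h => List.append_cancel_right h
    refine le_trans (ENNReal.tsum_le_tsum fun c => ?_)
      (ENNReal.tsum_comp_le_tsum_of_injective hinj _)
    by_cases hc : (∀ v ∈ c, v ∈ D) ∧ (c ++ [z]).head? = some y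
    · rw [if_pos hc, ← wordWeight_append_cons, if_pos]
      refine ⟨(isExit_append c (by simp)).2 ⟨hc.1, ht⟩, ?_⟩
      have := hc.2
      cases c <;> simp_all
    · rw [if_neg hc, zero_mul]
      exact zero_le
  intro htop
  rw [htop, ENNReal.top_mul hw] at h
  exact hy (top_le_iff.1 h)

/-- The matrix `1 - P` with the rows outside `D` replaced by those of the identity. -/
noncomputable def killedLaplacian (p : V → V → ℝ≥0∞) (D : Finset V) : Matrix V V ℝ :=
  Matrix.of fun u v => (if u = v then 1 else 0) - (if u ∈ D then (p u v).toReal else 0)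

theorem killedLaplacian_erase (p : V → V → ℝ≥0∞) (D : Finset V) (z : V) :
    killedLaplacian p (D.erase z) = (killedLaplacian p D).updateRow z (Pi.single z 1) := by
  ext u v
  by_cases hu : u = z
  · subst hu
    simp [killedLaplacian, Pi.single_apply, eq_comm]
  · simp [killedLaplacian, hu]

variable [Fintype V]

theorem killedLaplacian_mulVec_green {p : V → V → ℝ≥0∞} (hp : ∀ x y, p x y ≠ ∞) {D : Finset V}
    {z : V} (hz : z ∈ D) (hG : ∀ y ∈ D, green p D y z ≠ ∞) :
    (killedLaplacian p D).mulVec (fun y => (green p D y z).toReal) = Pi.single z 1 := by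
  have hG' : ∀ y, green p D y z ≠ ∞ := fun y => by
    by_cases hy : y ∈ D
    · exact hG y hy
    · simp [green_of_notMem p hy hz]
  ext u
  simp only [Matrix.mulVec, dotProduct, killedLaplacian, Matrix.of_apply, sub_mul, ite_mul, one_mul,
    zero_mul, Finset.sum_sub_distrib, Finset.sum_ite_eq, Finset.mem_univ, if_true]
  by_cases hu : u ∈ D
  · simp only [hu, if_true]
    have h1 : ∀ y ∈ Finset.univ, p u y * green p D y z ≠ ∞ :=
      fun y _ => ENNReal.mul_ne_top (hp u y) (hG' y)
    conv_lhs => enter [1]; rw [green_of_mem p hu]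
    rw [ENNReal.toReal_add (by split_ifs <;> simp) (ENNReal.sum_ne_top.2 h1),
      ENNReal.toReal_sum h1]
    simp only [ENNReal.toReal_mul, Pi.single_apply]
    split_ifs <;> simp
  · have : u ≠ z := by rintro rfl; exact hu hz
    simp [hu, green_of_notMem p hu hz, this]

/-- Cramer's rule. -/
theorem det_mul_green {p : V → V → ℝ≥0∞} (hp : ∀ x y, p x y ≠ ∞) {D : Finset V}
    {z : V} (hz : z ∈ D) (hG : ∀ y ∈ D, green p D y z ≠ ∞) :
    (killedLaplacian p D).det * (green p D z z).toReal = (killedLaplacian p (D.erase z)).det := by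
  have h := congrArg (fun g => (killedLaplacian p D).adjugate.mulVec g z)
    (killedLaplacian_mulVec_green hp hz hG)
  simp only [Matrix.mulVec_mulVec, Matrix.adjugate_mul, Matrix.smul_mulVec, Matrix.one_mulVec,
    Pi.smul_apply, smul_eq_mul, Matrix.mulVec_single_one, Matrix.col_apply] at h
  rw [h, Matrix.adjugate_apply, killedLaplacian_erase]

/-- Cramer's rule gives the sign of the determinants by induction on `D`, since Green's function is
nonnegative. -/
theorem det_killedLaplacian_pos {p : V → V → ℝ≥0∞} (hp : ∀ x y, p x y ≠ ∞) {D : Finset V}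
    (hG : ∀ D' ⊆ D, ∀ z ∈ D', ∀ y ∈ D', green p D' y z ≠ ∞) :
    0 < (killedLaplacian p D).det := by
  induction D using Finset.induction_on with
  | empty =>
    have : killedLaplacian p ∅ = 1 := by
      ext u v; simp [killedLaplacian, Matrix.one_apply]
    simp [this]
  | insert z D hz ih =>
    have h := det_mul_green hp (Finset.mem_insert_self z D)
      (hG _ subset_rfl z (Finset.mem_insert_self z D))
    rw [Finset.erase_insert hz] at h
    have hpos := ih fun D' hD' => hG D' (hD'.trans (Finset.subset_insert z D))
    rw [← h] at hpos
    exact pos_of_mul_pos_left hpos ENNReal.toReal_nonneg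

/-- The inverse of the determinant of `killedLaplacian p D`, which turns out to be the product of
the Green's functions met along any ordering of `D`. -/
noncomputable def greenDet (p : V → V → ℝ≥0∞) (D : Finset V) : ℝ≥0∞ :=
  ENNReal.ofReal (killedLaplacian p D).det⁻¹

theorem greenDet_empty (p : V → V → ℝ≥0∞) : greenDet p ∅ = 1 := by
  have : killedLaplacian p ∅ = 1 := by
    ext u v; simp [killedLaplacian, Matrix.one_apply]
  simp [greenDet, this]

theorem green_mul_greenDet {p : V → V → ℝ≥0∞} (hp : ∀ x y, p x y ≠ ∞) {D : Finset V}
    (hG : ∀ D' ⊆ D, ∀ z ∈ D', ∀ y ∈ D', green p D' y z ≠ ∞) {z : V} (hz : z ∈ D) :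
    green p D z z * greenDet p (D.erase z) = greenDet p D := by
  have h := det_mul_green hp hz (hG _ subset_rfl z hz)
  have h1 := det_killedLaplacian_pos hp hG
  have h2 := det_killedLaplacian_pos hp (D := D.erase z)
    fun D' hD' => hG D' (hD'.trans (Finset.erase_subset z D))
  rw [greenDet, greenDet, ← ENNReal.ofReal_toReal (hG _ subset_rfl z hz z hz),
    ← ENNReal.ofReal_mul ENNReal.toReal_nonneg]
  congr 1
  rw [← h] at h2 ⊢
  have h3 : (green p D z z).toReal ≠ 0 := by rintro h3; simp [h3] at h2
  field_simp

/-- The law of a loop-erased walk, with the product of Green's functions along the path expressed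
by determinants. -/
theorem exitSum_mul_greenDet {p : V → V → ℝ≥0∞} (hp : ∀ x y, p x y ≠ ∞) {D : Finset V}
    (hG : ∀ D' ⊆ D, ∀ z ∈ D', ∀ y ∈ D', green p D' y z ≠ ∞) {γ : List V} (hγ : IsExit D γ)
    (hnd : γ.Nodup) :
    exitSum p D γ * greenDet p (D \ γ.toFinset) = greenDet p D * wordWeight p γ := by
  induction γ generalizing D with
  | nil => exact hγ.elim
  | cons x r ih =>
    cases r with
    | nil =>
      rw [exitSum_singleton p hγ, wordWeight, one_mul, mul_one]
      congr 1
      ext v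
      simp only [List.toFinset_cons, List.toFinset_nil, Finset.mem_sdiff, Finset.mem_insert,
        Finset.notMem_empty, or_false, and_iff_left_iff_imp]
      rintro hv rfl
      exact hγ hv
    | cons y r =>
      obtain ⟨hx, hγ⟩ := hγ
      rw [List.nodup_cons] at hnd
      have hD : D \ (x :: y :: r).toFinset = D.erase x \ (y :: r).toFinset := by
        ext v; simp; tauto
      have ih' := ih (D := D.erase x) (fun D' hD' => hG D' (hD'.trans (Finset.erase_subset x D)))
        ((isExit_erase hnd.1).2 hγ) hnd.2
      rw [exitSum_cons p hx hnd.1, hD, mul_assoc, mul_assoc, ih', ← green_mul_greenDet hp hG hx,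
        wordWeight]
      ring

end Determinant

/-! ### The stopped walk -/

section ExitWord

variable {V : Type*}

open Classical in
/-- The path of the trajectory `y` up to the first time at which it is outside `D`, and `none` if
there is no such time. -/
noncomputable def exitWord (D : Finset V) (y : ℕ → V) : Option (List V) :=
  if h : ∃ t, y t ∉ D then some ((List.range (Nat.find h + 1)).map y) else none

theorem exitWord_eq_some {D : Finset V} {y : ℕ → V} {w : List V} :
    exitWord D y = some w ↔ IsExit D w ∧ (List.range w.length).map y = w := by
  classical
  constructor
  · intro h
    unfold exitWord at h
    split_ifs at h with he
    obtain rfl := Option.some.inj h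
    refine ⟨?_, by simp⟩
    rw [List.range_succ, List.map_append, List.map_singleton, isExit_append _ (by simp)]
    refine ⟨?_, Nat.find_spec he⟩
    intro v hv
    obtain ⟨i, hi, rfl⟩ := List.mem_map.1 hv
    exact not_not.1 (Nat.find_min he (List.mem_range.1 hi))
  · rintro ⟨hw, hy⟩
    obtain ⟨c, z, rfl, hc, hz⟩ := isExit_iff.1 hw
    rw [List.length_append, List.length_singleton, List.range_succ, List.map_append,
      List.map_singleton] at hy
    obtain ⟨h1, h2⟩ := List.append_inj' hy rfl
    have h2 : y c.length = z := by simpa using h2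
    have he : ∃ t, y t ∉ D := ⟨c.length, h2 ▸ hz⟩
    have hf : Nat.find he = c.length := by
      rw [Nat.find_eq_iff]
      refine ⟨h2 ▸ hz, fun n hn => not_not.2 (hc _ ?_)⟩
      rw [← h1]
      exact List.mem_map.2 ⟨n, List.mem_range.2 hn, rfl⟩
    rw [exitWord, dif_pos he, hf, List.range_succ, List.map_append, List.map_singleton, h1, h2]

theorem exitWord_isSome {D : Finset V} {y : ℕ → V} (h : ∃ t, y t ∉ D) :
    ∃ w, exitWord D y = some w := by
  classical
  exact ⟨_, dif_pos h⟩

theorem head?_of_exitWord {D : Finset V} {y : ℕ → V} {w : List V} (h : exitWord D y = some w) :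
    w.head? = some (y 0) := by
  obtain ⟨hw, hy⟩ := exitWord_eq_some.1 h
  cases w with
  | nil => exact hw.elim
  | cons x l =>
    rw [List.length_cons, List.range_succ_eq_map] at hy
    simp at hy
    simp [hy.1]

theorem measurableSet_prefix [MeasurableSpace V] [MeasurableSingletonClass V] (w : List V) :
    MeasurableSet {y : ℕ → V | (List.range w.length).map y = w} := by
  have : {y : ℕ → V | (List.range w.length).map y = w} =
      ⋂ i : Fin w.length, (fun y : ℕ → V => y i) ⁻¹' {w[i]} := by
    ext y
    simp only [Set.mem_ofPred_eq, Set.mem_iInter, Set.mem_preimage, Set.mem_singleton_iff]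
    constructor
    · intro h i
      have := List.getElem_of_eq h (i := i) (by simp)
      simpa using this
    · intro h
      refine List.ext_getElem (by simp) fun i h1 h2 => ?_
      simpa using h ⟨i, h2⟩
  rw [this]
  exact MeasurableSet.iInter fun i => measurable_pi_apply _ (measurableSet_singleton _)

theorem measurableSet_exitWord_eq_some [MeasurableSpace V] [MeasurableSingletonClass V]
    (D : Finset V) (w : List V) : MeasurableSet {y : ℕ → V | exitWord D y = some w} := by
  simp_rw [exitWord_eq_some]
  by_cases h : IsExit D w
  · simpa [h] using measurableSet_prefix w
  · simp [h]

end ExitWord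

section Walk

variable {V : Type*} [Fintype V] {G : SimpleGraph V} [DecidableRel G.Adj]

theorem srwStep_ne_top (hG : ∀ v, 0 < G.degree v) (v w : V) : srwStep G v w ≠ ∞ := by
  unfold srwStep
  split_ifs
  · simpa using (hG v).ne'
  · simp

theorem isChain_of_wordWeight_ne_zero {w : List V} (h : wordWeight (srwStep G) w ≠ 0) :
    w.IsChain G.Adj := by
  induction w with
  | nil => simp
  | cons x l ih =>
    cases l with
    | nil => simp
    | cons y l =>
      rw [wordWeight] at h
      rw [List.isChain_cons_cons]
      refine ⟨?_, ih (right_ne_zero_of_mul h)⟩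
      by_contra hxy
      exact left_ne_zero_of_mul h (by simp [srwStep, hxy])

/-- In a connected graph the walk can leave `D` from everywhere. -/
theorem exists_isExit (hG : G.Connected) {a : V} {D : Finset V} (ha : a ∉ D) (z : V) :
    ∃ t, IsExit D (z :: t) ∧ wordWeight (srwStep G) (z :: t) ≠ 0 := by
  obtain ⟨q⟩ := hG.preconnected z a
  induction q with
  | nil => exact ⟨[], ha, by simp [wordWeight]⟩
  | @cons u v w h q ih =>
    obtain ⟨t, h1, h2⟩ := ih ha
    by_cases hu : u ∈ D
    · refine ⟨v :: t, ⟨hu, h1⟩, ?_⟩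
      rw [wordWeight]
      refine mul_ne_zero ?_ h2
      simp [srwStep, h]
    · exact ⟨[], hu, by simp [wordWeight]⟩

variable [MeasurableSpace V] {Ω : Type*} [MeasurableSpace Ω] {μ : Measure Ω}

theorem IsSimpleRandomWalk.measurable_trajectory {x : V} {Y : ℕ → Ω → V}
    (hY : IsSimpleRandomWalk G x Y μ) : Measurable fun ω t => Y t ω :=
  measurable_pi_lambda _ hY.measurable

variable [MeasurableSingletonClass V]

open Classical in
/-- The probability that a simple random walk begins with a given word. -/
theorem IsSimpleRandomWalk.measure_prefix [IsProbabilityMeasure μ] {x : V} {Y : ℕ → Ω → V}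
    (hY : IsSimpleRandomWalk G x Y μ) {w : List V} (hw : w ≠ []) :
    μ {ω | (List.range w.length).map (fun t => Y t ω) = w} =
      if w.head? = some x then wordWeight (srwStep G) w else 0 := by
  induction w using List.reverseRecOn with
  | nil => exact absurd rfl hw
  | append_singleton l v ih =>
    rcases List.eq_nil_or_concat l with rfl | ⟨c, u, rfl⟩
    · have h1 : {ω | (List.range ([] ++ [v]).length).map (fun t => Y t ω) = [] ++ [v]} =
          {ω | Y 0 ω = v} := by
        ext ω; simp
      rw [h1]
      by_cases hv : v = x
      · subst hv
        have := (prob_compl_eq_zero_iff ((hY.measurable 0) (measurableSet_singleton v))).1 hY.start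
        simp only [List.nil_append, List.head?_cons, if_true, wordWeight]
        exact this
      · simp only [List.nil_append, List.head?_cons, Option.some.injEq, hv, if_false]
        refine measure_mono_null (fun ω (h : Y 0 ω = v) => ?_) hY.start
        exact fun h' => hv (h.symm.trans h')
    · rw [List.concat_eq_append] at ih ⊢
      have ih := ih (by simp)
      let q : ℕ → V := fun i => (c ++ [u])[i]?.getD u
      have hq : q c.length = u := by simp [q]
      have hset : ∀ ω, (∀ i ≤ c.length, Y i ω = q i) ↔
          (List.range (c ++ [u]).length).map (fun t => Y t ω) = c ++ [u] := by
        intro ω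
        constructor
        · intro h
          refine List.ext_getElem (by simp) fun i h1 h2 => ?_
          have := h i (by simp at h2; omega)
          simp only [List.getElem_map, List.getElem_range, this, q]
          rw [List.getElem?_eq_getElem h2]; rfl
        · intro h i hi
          have h2 : i < (c ++ [u]).length := by simp; omega
          have := List.getElem_of_eq h (i := i) (by simpa using h2)
          simp only [List.getElem_map, List.getElem_range] at this
          rw [this]
          simp only [q]
          rw [List.getElem?_eq_getElem h2]; rfl
      have h1 : {ω | (List.range (c ++ [u] ++ [v]).length).map (fun t => Y t ω) = c ++ [u] ++ [v]} =
          {ω | (∀ i ≤ c.length, Y i ω = q i) ∧ Y (c.length + 1) ω = v} := by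
        ext ω
        simp only [Set.mem_ofPred_eq]
        rw [hset, List.length_append, List.length_singleton, List.range_succ, List.map_append,
          List.map_singleton, List.append_singleton_inj, List.length_append, List.length_singleton]
      rw [h1, hY.step, hq]
      simp_rw [hset]
      rw [ih, List.append_assoc, List.singleton_append]
      have h3 : wordWeight (srwStep G) [u, v] = srwStep G u v := by simp [wordWeight]
      have h2 : (c ++ u :: [v]).head? = (c ++ [u]).head? := by cases c <;> simp
      rw [h2]
      rw [wordWeight_append_cons (srwStep G) c u [v], h3]
      split_ifs <;> simp

open Classical in
theorem IsSimpleRandomWalk.measure_exitWord [IsProbabilityMeasure μ] {x : V} {Y : ℕ → Ω → V}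
    (hY : IsSimpleRandomWalk G x Y μ) (D : Finset V) (w : List V) :
    μ {ω | exitWord D (fun t => Y t ω) = some w} =
      if IsExit D w ∧ w.head? = some x then wordWeight (srwStep G) w else 0 := by
  simp_rw [exitWord_eq_some]
  by_cases h : IsExit D w
  · simp only [h, true_and]
    exact hY.measure_prefix h.ne_nil
  · simp [h]

open Classical in
/-- The weights are the probabilities of the disjoint events that the stopped walk is `w`. -/
theorem IsSimpleRandomWalk.tsum_exit_le_one [IsProbabilityMeasure μ] {x : V} {Y : ℕ → Ω → V}
    (hY : IsSimpleRandomWalk G x Y μ) (D : Finset V) :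
    ∑' w : List V, (if IsExit D w ∧ w.head? = some x then wordWeight (srwStep G) w else 0) ≤ 1 := by
  simp_rw [← hY.measure_exitWord D]
  rw [← measure_univ (μ := μ)]
  refine tsum_measure_le_measure_univ
    (fun w => (hY.measurable_trajectory (measurableSet_exitWord_eq_some D w)).nullMeasurableSet) ?_
  intro w w' hww
  refine Disjoint.aedisjoint (Set.disjoint_left.2 fun ω h h' => hww ?_)
  exact Option.some.inj (Eq.trans (Eq.symm h) h')

/-- A chain whose Green's function is finite leaves `D` almost surely, by Borel–Cantelli: the words
`c ++ [z]` that stay in `D` and are prefixes of the walk are finitely many. -/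
theorem IsSimpleRandomWalk.ae_exists_notMem [DecidableEq V] [IsProbabilityMeasure μ] {x : V}
    {Y : ℕ → Ω → V}
    (hY : IsSimpleRandomWalk G x Y μ) {D : Finset V} (hD : ∀ z ∈ D, green (srwStep G) D x z ≠ ∞) :
    ∀ᵐ ω ∂μ, ∃ t, Y t ω ∉ D := by
  classical
  let s : V × List V → Set Ω := fun q =>
    {ω | q.1 ∈ D ∧ (∀ v ∈ q.2, v ∈ D) ∧
      (List.range (q.2 ++ [q.1]).length).map (fun t => Y t ω) = q.2 ++ [q.1]}
  have hs : ∑' q, μ (s q) ≠ ∞ := by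
    have h1 : ∀ q, μ (s q) = if q.1 ∈ D then (if (∀ v ∈ q.2, v ∈ D) ∧ (q.2 ++ [q.1]).head? = some x
        then wordWeight (srwStep G) (q.2 ++ [q.1]) else 0) else 0 := by
      intro q
      by_cases hq : q.1 ∈ D <;> by_cases hq' : ∀ v ∈ q.2, v ∈ D
      · simp only [s, hq, true_and, if_true]
        rw [if_congr (and_iff_right hq') rfl rfl]
        convert hY.measure_prefix (w := q.2 ++ [q.1]) (by simp) using 2
        ext ω
        exact and_iff_right hq'
      · have : s q = ∅ := by ext ω; simp only [s, hq', false_and, and_false]; rfl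
        rw [this, if_pos hq, if_neg (fun h => hq' h.1), measure_empty]
      · have : s q = ∅ := by ext ω; simp only [s, hq, false_and]; rfl
        rw [this, if_neg hq, measure_empty]
      · have : s q = ∅ := by ext ω; simp only [s, hq, false_and]; rfl
        rw [this, if_neg hq, measure_empty]
    simp_rw [h1]
    rw [ENNReal.tsum_prod (f := fun z c => if z ∈ D then (if (∀ v ∈ c, v ∈ D) ∧
      (c ++ [z]).head? = some x then wordWeight (srwStep G) (c ++ [z]) else 0) else 0),
      tsum_fintype]
    refine ENNReal.sum_ne_top.2 fun z _ => ?_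
    by_cases hz : z ∈ D
    · simp only [hz, if_true]
      have h2 := hD z hz
      rw [green] at h2
      convert h2
    · simp [hz]
  filter_upwards [ae_finite_setOfPred_mem hs] with ω hω
  by_contra hno
  push Not at hno
  refine Set.infinite_of_injective_forall_mem (f := fun t => (Y t ω, (List.range t).map
    fun t => Y t ω)) ?_ ?_ hω
  · intro t t' h
    have := congrArg (fun q : V × List V => q.2.length) h
    simpa using this
  · intro t
    refine ⟨hno t, ?_, ?_⟩
    · intro v hv
      obtain ⟨i, -, rfl⟩ := List.mem_map.1 hv
      exact hno i
    · simp [List.range_succ]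

theorem IsSimpleRandomWalk.ae_isChain [IsProbabilityMeasure μ] {x : V} {Y : ℕ → Ω → V}
    (hY : IsSimpleRandomWalk G x Y μ) :
    ∀ᵐ ω ∂μ, ∀ n, ((List.range n).map fun t => Y t ω).IsChain G.Adj := by
  classical
  have h : ∀ᵐ ω ∂μ, ∀ w : List V, (List.range w.length).map (fun t => Y t ω) = w →
      w.IsChain G.Adj := by
    rw [ae_all_iff]
    intro w
    by_cases hw : w.IsChain G.Adj
    · exact Filter.Eventually.of_forall fun _ _ => hw
    · have hne : w ≠ [] := by rintro rfl; simp at hw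
      have h0 := hY.measure_prefix hne
      rw [not_ne_iff.1 (mt isChain_of_wordWeight_ne_zero hw), ite_self] at h0
      refine Filter.Eventually.mono (measure_eq_zero_iff_ae_notMem.1 h0) fun ω h1 h2 => ?_
      exact absurd h2 h1
  filter_upwards [h] with ω hω n
  exact hω _ (by simp)

end Walk

/-! ### Growing a single tree -/

section Growth

variable {V : Type*} [DecidableEq V]

theorem pathEdges_cons_cons (x y : V) (r : List V) :
    pathEdges (x :: y :: r) = insert s(x, y) (pathEdges (y :: r)) := by
  simp [pathEdges]

theorem PartialTree.addPath_singleton {T : PartialTree V} {z : V} (hz : z ∈ T.verts) :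
    T.addPath [z] = T := by
  cases T
  simp_all [addPath, pathEdges]

theorem PartialTree.addPath_cons_cons (T : PartialTree V) (x y : V) (r : List V) :
    T.addPath (x :: y :: r) =
      ⟨insert x (T.addPath (y :: r)).verts, insert s(x, y) (T.addPath (y :: r)).edges⟩ := by
  simp only [addPath, pathEdges_cons_cons, PartialTree.mk.injEq]
  constructor
  · ext v; simp
  · ext v; simp

theorem isChain_adj_of_pathEdges_subset {γ : List V} {E : Finset (Sym2 V)} (hnd : γ.Nodup)
    (h : pathEdges γ ⊆ E) : γ.IsChain (SimpleGraph.fromEdgeSet (E : Set (Sym2 V))).Adj := by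
  induction γ with
  | nil => simp
  | cons x r ih =>
    cases r with
    | nil => simp
    | cons y r =>
      rw [pathEdges_cons_cons, Finset.insert_subset_iff] at h
      rw [List.nodup_cons] at hnd
      rw [List.isChain_cons_cons, SimpleGraph.fromEdgeSet_adj]
      refine ⟨⟨by exact_mod_cast h.1, ?_⟩, ih hnd.2 h.2⟩
      rintro rfl
      exact hnd.1 (by simp)

variable [Fintype V]

/-- Adding a loop-erased path amounts to adding leaves one after the other, starting from the end
of the path. -/
theorem PartialTree.addPath_induction {P : PartialTree V → Prop} {R : V → V → Prop}
    (step : ∀ T x y, P T → x ∉ T.verts → y ∈ T.verts → R x y →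
      P ⟨insert x T.verts, insert s(x, y) T.edges⟩)
    {T : PartialTree V} (hT : P T) {γ : List V} (hγ : IsExit T.vertsᶜ γ) (hnd : γ.Nodup)
    (hR : γ.IsChain R) : P (T.addPath γ) := by
  induction γ with
  | nil => exact hγ.elim
  | cons x r ih =>
    cases r with
    | nil =>
      rw [addPath_singleton (by simpa [IsExit] using hγ)]
      exact hT
    | cons y r =>
      obtain ⟨hx, hγ⟩ := hγ
      rw [List.nodup_cons] at hnd
      rw [List.isChain_cons_cons] at hR
      rw [addPath_cons_cons]
      refine step _ x y (ih hγ hnd.2 hR.2) ?_ (by simp [addPath]) hR.1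
      simp only [addPath, Finset.mem_union, List.mem_toFinset, not_or]
      exact ⟨by simpa using hx, hnd.1⟩

/-- One iteration of the sampling algorithm when the two trees are regarded as a single one. -/
noncomputable def joinStep (T : PartialTree V) (y : ℕ → V) : Option (PartialTree V) :=
  (exitWord T.vertsᶜ y).map fun w => T.addPath (loopErasure w)

/-- The iterations of the sampling algorithm for the indices in `l`, on a single tree. -/
noncomputable def joinRun {ι : Type*} (y : ι → ℕ → V) (l : List ι) (T : PartialTree V) :
    Option (PartialTree V) :=
  l.foldlM (fun T i => joinStep T (y i)) T

/-- The tree obtained from two trees by adding the edge `{a, b}`. -/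
def mergeTrees (a b : V) (F : PartialTree V × PartialTree V) : PartialTree V :=
  ⟨F.1.verts ∪ F.2.verts, F.1.edges ∪ F.2.edges ∪ {s(a, b)}⟩

theorem map_mergeTrees_wilsonStep (a b : V) (F : PartialTree V × PartialTree V) (y : ℕ → V) :
    (wilsonStep F y).map (mergeTrees a b) = joinStep (mergeTrees a b F) y := by
  classical
  by_cases h : ∃ t, y t ∈ F.1.verts ∪ F.2.verts
  · have he : exitWord (mergeTrees a b F).vertsᶜ y =
        some ((List.range (Nat.find h + 1)).map y) := by
      rw [exitWord_eq_some]
      refine ⟨?_, by simp⟩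
      rw [List.range_succ, List.map_append, List.map_singleton, isExit_append _ (by simp)]
      refine ⟨?_, fun hn => Finset.mem_compl.1 hn (Nat.find_spec h)⟩
      intro v hv
      obtain ⟨i, hi, rfl⟩ := List.mem_map.1 hv
      simpa [mergeTrees] using Nat.find_min h (List.mem_range.1 hi)
    rw [joinStep, he, wilsonStep, dif_pos h]
    simp only [Option.map_some]
    set γ := loopErasure ((List.range (Nat.find h + 1)).map y) with hγ
    split_ifs with h1
    · simp only [Option.map_some, mergeTrees, PartialTree.addPath, Option.some.injEq,
        PartialTree.mk.injEq]
      constructor <;> ext v <;> simp only [Finset.mem_union] <;> tauto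
    · simp only [Option.map_some, mergeTrees, PartialTree.addPath, Option.some.injEq,
        PartialTree.mk.injEq]
      constructor <;> ext v <;> simp only [Finset.mem_union] <;> tauto
  · rw [joinStep, wilsonStep, dif_neg h, exitWord, dif_neg]
    · rfl
    · simpa [mergeTrees] using h

theorem map_mergeTrees_foldlM {ι : Type*} (a b : V) (y : ι → ℕ → V) (l : List ι)
    (F : PartialTree V × PartialTree V) :
    (l.foldlM (fun F i => wilsonStep F (y i)) F).map (mergeTrees a b) =
      joinRun y l (mergeTrees a b F) := by
  induction l generalizing F with
  | nil => rfl
  | cons i l ih =>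
    rw [joinRun, List.foldlM_cons, List.foldlM_cons, ← map_mergeTrees_wilsonStep]
    cases wilsonStep F (y i) with
    | none => rfl
    | some F' => exact ih F'

/-- The tree that consists of the edge `{a, b}`. -/
def PartialTree.edge (a b : V) : PartialTree V :=
  ⟨{a, b}, {s(a, b)}⟩

/-- The two trees of the sampling algorithm may be joined by the edge `{a, b}` at the beginning
instead of at the end. -/
theorem wilsonSampling_eq (a b : V) (order : List {x : V // x ≠ a ∧ x ≠ b})
    (y : {x : V // x ≠ a ∧ x ≠ b} → ℕ → V) :
    wilsonSampling a b order y = (joinRun y order (PartialTree.edge a b)).map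
      fun T => SimpleGraph.fromEdgeSet (T.edges : Set (Sym2 V)) := by
  have h : mergeTrees a b (PartialTree.single a, PartialTree.single b) = PartialTree.edge a b := by
    simp only [mergeTrees, PartialTree.single, PartialTree.edge, PartialTree.mk.injEq]
    constructor <;> ext v <;> simp
  rw [← h, ← map_mergeTrees_foldlM, Option.map_map, wilsonSampling]
  congr 1
  ext1 F
  simp [mergeTrees]

theorem joinRun_cons_eq_some {ι : Type*} {y : ι → ℕ → V} {i : ι} {l : List ι}
    {T F : PartialTree V} : joinRun y (i :: l) T = some F ↔
      ∃ w, exitWord T.vertsᶜ (y i) = some w ∧ joinRun y l (T.addPath (loopErasure w)) = some F := by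
  rw [joinRun, List.foldlM_cons, joinStep]
  cases h : exitWord T.vertsᶜ (y i) with
  | none => simp
  | some w => simp [joinRun]

theorem joinRun_nil_eq_some {ι : Type*} {y : ι → ℕ → V} {T F : PartialTree V} :
    joinRun y [] T = some F ↔ T = F := by
  simp [joinRun]

theorem joinRun_congr {ι : Type*} {y y' : ι → ℕ → V} {l : List ι} (h : ∀ i ∈ l, y i = y' i)
    (T : PartialTree V) : joinRun y l T = joinRun y' l T := by
  induction l generalizing T with
  | nil => rfl
  | cons i l ih =>
    ext F
    rw [joinRun_cons_eq_some, joinRun_cons_eq_some, h i (by simp)]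
    simp_rw [ih fun j hj => h j (List.mem_cons_of_mem i hj)]

theorem joinRun_mono {ι : Type*} {y : ι → ℕ → V} {l : List ι} {T F : PartialTree V}
    (h : joinRun y l T = some F) : T.verts ⊆ F.verts ∧ T.edges ⊆ F.edges := by
  induction l generalizing T with
  | nil => rw [joinRun_nil_eq_some.1 h]; exact ⟨subset_rfl, subset_rfl⟩
  | cons i l ih =>
    obtain ⟨w, -, hw⟩ := joinRun_cons_eq_some.1 h
    exact ⟨Finset.subset_union_left.trans (ih hw).1, Finset.subset_union_left.trans (ih hw).2⟩

theorem mem_verts_of_joinRun {ι : Type*} {y : ι → ℕ → V} {l : List ι} {T F : PartialTree V}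
    (h : joinRun y l T = some F) {i : ι} (hi : i ∈ l) : y i 0 ∈ F.verts := by
  induction l generalizing T with
  | nil => simp at hi
  | cons j l ih =>
    obtain ⟨w, h1, hw⟩ := joinRun_cons_eq_some.1 h
    rcases List.mem_cons.1 hi with rfl | hi
    · refine (joinRun_mono hw).1 (Finset.mem_union_right _ (List.mem_toFinset.2 ?_))
      have := head?_of_exitWord h1
      rw [← head?_loopErasure] at this
      exact List.mem_of_head? this
    · exact ih hw hi

theorem exists_joinRun_eq_some {ι : Type*} {y : ι → ℕ → V} (l : List ι) {T : PartialTree V}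
    (h : ∀ i, ∃ t, y i t ∈ T.verts) : ∃ F, joinRun y l T = some F := by
  induction l generalizing T with
  | nil => exact ⟨T, joinRun_nil_eq_some.2 rfl⟩
  | cons i l ih =>
    obtain ⟨w, hw⟩ := exitWord_isSome (D := T.vertsᶜ) (y := y i) (by simpa using h i)
    obtain ⟨F, hF⟩ := ih (T := T.addPath (loopErasure w))
      fun j => (h j).imp fun t ht => Finset.mem_union_left _ ht
    exact ⟨F, joinRun_cons_eq_some.2 ⟨w, hw, hF⟩⟩

/-- Properties of individual leaf additions are inherited by the result of the algorithm. -/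
theorem joinRun_induction {ι : Type*} {P : PartialTree V → Prop} {R : V → V → Prop}
    (step : ∀ T x y, P T → x ∉ T.verts → y ∈ T.verts → R x y →
      P ⟨insert x T.verts, insert s(x, y) T.edges⟩)
    {y : ι → ℕ → V} {l : List ι} (hy : ∀ i n, ((List.range n).map (y i)).IsChain R)
    {T F : PartialTree V} (hT : P T) (h : joinRun y l T = some F) : P F := by
  induction l generalizing T with
  | nil => rwa [← joinRun_nil_eq_some.1 h]
  | cons i l ih =>
    obtain ⟨w, h1, hw⟩ := joinRun_cons_eq_some.1 h
    refine ih (PartialTree.addPath_induction step hT ?_ (nodup_loopErasure w) ?_) hw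
    · exact (exitWord_eq_some.1 h1).1.loopErasure
    · refine isChain_loopErasure ?_
      rw [← (exitWord_eq_some.1 h1).2]
      exact hy i _

/-! ### The output is a spanning tree -/

/-- The edges of `T` are edges of `G`, they connect the vertices of `T` to `a`, and there are fewer
edges than vertices. -/
structure IsPartialTree (G : SimpleGraph V) (a : V) (T : PartialTree V) : Prop where
  reachable : ∀ v ∈ T.verts, (SimpleGraph.fromEdgeSet (T.edges : Set (Sym2 V))).Reachable v a
  card_le : T.edges.card + 1 ≤ T.verts.card
  edges_subset : (T.edges : Set (Sym2 V)) ⊆ G.edgeSet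

omit [Fintype V] in
theorem IsPartialTree.insert_leaf {G : SimpleGraph V} {a : V} {T : PartialTree V}
    (hT : IsPartialTree G a T) {x y : V} (hx : x ∉ T.verts) (hy : y ∈ T.verts) (hxy : G.Adj x y) :
    IsPartialTree G a ⟨insert x T.verts, insert s(x, y) T.edges⟩ := by
  have hle : SimpleGraph.fromEdgeSet (T.edges : Set (Sym2 V)) ≤
      SimpleGraph.fromEdgeSet ((insert s(x, y) T.edges : Finset (Sym2 V)) : Set (Sym2 V)) :=
    SimpleGraph.fromEdgeSet_mono (by simp)
  refine ⟨?_, ?_, ?_⟩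
  · intro v hv
    rcases Finset.mem_insert.1 hv with rfl | hv
    · refine SimpleGraph.Reachable.trans (SimpleGraph.Adj.reachable ?_)
        ((hT.reachable y hy).mono hle)
      rw [SimpleGraph.fromEdgeSet_adj]
      exact ⟨by simp, hxy.ne⟩
    · exact (hT.reachable v hv).mono hle
  · rw [Finset.card_insert_of_notMem hx]
    have := Finset.card_insert_le s(x, y) T.edges
    have := hT.card_le
    dsimp only
    omega
  · rw [Finset.coe_insert, Set.insert_subset_iff]
    exact ⟨hxy, hT.edges_subset⟩

omit [Fintype V] in
theorem isPartialTree_edge {G : SimpleGraph V} {a b : V} (hab : G.Adj a b) :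
    IsPartialTree G a (PartialTree.edge a b) := by
  refine ⟨?_, ?_, ?_⟩
  · intro v hv
    rcases Finset.mem_insert.1 hv with rfl | hv
    · exact SimpleGraph.Reachable.rfl
    · rw [Finset.mem_singleton.1 hv]
      refine SimpleGraph.Adj.reachable ?_
      rw [SimpleGraph.fromEdgeSet_adj]
      exact ⟨by simp [PartialTree.edge, Sym2.eq_swap], hab.ne'⟩
  · simp [PartialTree.edge, hab.ne]
  · simpa [PartialTree.edge] using hab

omit [DecidableEq V] in
/-- A connected spanning graph with at most `n - 1` edges is a tree. -/
theorem IsPartialTree.isTree {G : SimpleGraph V} {a : V} {T : PartialTree V}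
    (hT : IsPartialTree G a T) (h : ∀ v, v ∈ T.verts) :
    SimpleGraph.fromEdgeSet (T.edges : Set (Sym2 V)) ≤ G ∧
      (SimpleGraph.fromEdgeSet (T.edges : Set (Sym2 V))).IsTree := by
  have hc : (SimpleGraph.fromEdgeSet (T.edges : Set (Sym2 V))).Connected :=
    { preconnected := fun u v =>
        (hT.reachable u (h u)).trans (hT.reachable v (h v)).symm
      nonempty := ⟨a⟩ }
  refine ⟨?_, SimpleGraph.isTree_iff_connected_and_card.2 ⟨hc, le_antisymm ?_
    hc.card_vert_le_card_edgeSet_add_one⟩⟩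
  · intro u v huv
    exact hT.edges_subset ((SimpleGraph.fromEdgeSet_adj _).1 huv).1
  · have h1 : Nat.card (SimpleGraph.fromEdgeSet (T.edges : Set (Sym2 V))).edgeSet ≤
        T.edges.card := by
      rw [SimpleGraph.edgeSet_fromEdgeSet, Nat.card_coe_set_eq, ← Set.ncard_coe_finset]
      exact Set.ncard_le_ncard Set.sdiff_subset (Finset.finite_toSet _)
    have h2 := hT.card_le
    rw [Finset.eq_univ_iff_forall.2 h, Finset.card_univ, ← Nat.card_eq_fintype_card] at h2
    omega

theorem joinRun_mem_spanningTreesThrough {G : SimpleGraph V} {a b : V} (hab : G.Adj a b)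
    {ι : Type*} {y : ι → ℕ → V} {l : List ι}
    (hy : ∀ i n, ((List.range n).map (y i)).IsChain G.Adj)
    (hl : ∀ v, v ≠ a → v ≠ b → ∃ i ∈ l, y i 0 = v) {F : PartialTree V}
    (h : joinRun y l (PartialTree.edge a b) = some F) :
    SimpleGraph.fromEdgeSet (F.edges : Set (Sym2 V)) ∈ spanningTreesThrough G a b := by
  have hF : IsPartialTree G a F := joinRun_induction
    (fun T x y hT hx hy hxy => IsPartialTree.insert_leaf hT hx hy hxy) hy (isPartialTree_edge hab) h
  have hmono := joinRun_mono h
  have hv : ∀ v, v ∈ F.verts := by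
    intro v
    by_cases hva : v = a
    · exact hmono.1 (by simp [PartialTree.edge, hva])
    by_cases hvb : v = b
    · exact hmono.1 (by simp [PartialTree.edge, hvb])
    obtain ⟨i, hi, rfl⟩ := hl v hva hvb
    exact mem_verts_of_joinRun h hi
  refine ⟨(hF.isTree hv).1, (hF.isTree hv).2, ?_⟩
  rw [SimpleGraph.fromEdgeSet_adj]
  exact ⟨hmono.2 (by simp [PartialTree.edge]), hab.ne⟩

end Growth

/-! ### Rooted spanning trees -/

section Parent

variable {V : Type*} [DecidableEq V] [Fintype V]

/-- `par` is the parent function, and `d` a height function, of the tree `t` with root `a`: the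
edges of `t` are those that join the vertices `v ≠ a` to `par v`. -/
structure IsParent (t : SimpleGraph V) (a : V) (par : V → V) (d : V → ℕ) : Prop where
  lt : ∀ v, v ≠ a → d (par v) < d v
  adj : ∀ u v, t.Adj u v ↔ (u ≠ a ∧ v = par u) ∨ (v ≠ a ∧ u = par v)

omit [DecidableEq V] in
/-- The parent of `v` is a neighbour that is closer to the root. The `n - 1` edges from the vertices
`v ≠ a` to their parents are distinct, so that there are no others. -/
theorem SimpleGraph.IsTree.exists_isParent {t : SimpleGraph V} (ht : t.IsTree) (a : V) :
    ∃ par d, IsParent t a par d := by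
  classical
  have h : ∀ v, ∃ u, v ≠ a → t.Adj v u ∧ t.dist u a < t.dist v a := by
    intro v
    by_cases hv : v = a
    · exact ⟨v, fun h => absurd hv h⟩
    · obtain ⟨q, hq⟩ := (ht.connected.preconnected v a).exists_walk_length_eq_dist
      cases q with
      | nil => exact absurd rfl hv
      | cons hvu q =>
        refine ⟨_, fun _ => ⟨hvu, ?_⟩⟩
        rw [← hq, SimpleGraph.Walk.length_cons]
        exact Nat.lt_succ_of_le (SimpleGraph.dist_le q)
  choose par hpar using h
  have himg : (Finset.univ.erase a).image (fun v => s(v, par v)) = t.edgeFinset := by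
    refine Finset.eq_of_subset_of_card_le ?_ ?_
    · intro e he
      obtain ⟨v, hv, rfl⟩ := Finset.mem_image.1 he
      rw [SimpleGraph.mem_edgeFinset]
      exact (hpar v (Finset.ne_of_mem_erase hv)).1
    · rw [Finset.card_image_of_injOn]
      · have := ht.card_edgeFinset
        rw [Finset.card_erase_of_mem (Finset.mem_univ a), Finset.card_univ]
        omega
      · intro u hu v hv huv
        have hu := hpar u (Finset.ne_of_mem_erase hu)
        have hv := hpar v (Finset.ne_of_mem_erase hv)
        rcases Sym2.eq_iff.1 huv with h | h
        · exact h.1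
        · rw [h.2] at hu
          rw [← h.1] at hv
          exact absurd (hu.2.trans hv.2) (lt_irrefl _)
  refine ⟨par, fun v => t.dist v a, fun v hv => (hpar v hv).2, fun u v => ?_⟩
  rw [← SimpleGraph.mem_edgeSet, ← SimpleGraph.mem_edgeFinset, ← himg, Finset.mem_image]
  constructor
  · rintro ⟨w, hw, he⟩
    rcases Sym2.eq_iff.1 he with ⟨rfl, rfl⟩ | ⟨rfl, rfl⟩
    · exact Or.inl ⟨Finset.ne_of_mem_erase hw, rfl⟩
    · exact Or.inr ⟨Finset.ne_of_mem_erase hw, rfl⟩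
  · rintro (⟨hu, rfl⟩ | ⟨hv, rfl⟩)
    · exact ⟨u, by simp [hu], rfl⟩
    · exact ⟨v, by simp [hv], Sym2.eq_swap⟩

/-- `T` is the part, on a set of vertices that contains the root and is closed under taking
parents, of the tree with root `a` and parent function `par`. -/
structure IsRootedSubtree (a : V) (par : V → V) (T : PartialTree V) : Prop where
  root_mem : a ∈ T.verts
  par_mem : ∀ v ∈ T.verts, v ≠ a → par v ∈ T.verts
  mem_edges : ∀ e, e ∈ T.edges ↔ ∃ v ∈ T.verts, v ≠ a ∧ e = s(v, par v)

theorem IsRootedSubtree.addPath {a : V} {par : V → V} {T : PartialTree V}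
    (hT : IsRootedSubtree a par T) {γ : List V} (hγ : IsExit T.vertsᶜ γ) (hnd : γ.Nodup)
    (hR : γ.IsChain fun u v => v = par u) : IsRootedSubtree a par (T.addPath γ) := by
  refine PartialTree.addPath_induction (P := IsRootedSubtree a par) ?_ hT hγ hnd hR
  rintro T x y hT hx hy rfl
  have hxa : x ≠ a := by rintro rfl; exact hx hT.root_mem
  refine ⟨Finset.mem_insert_of_mem hT.root_mem, ?_, ?_⟩
  · intro v hv hva
    rcases Finset.mem_insert.1 hv with rfl | hv
    · exact Finset.mem_insert_of_mem hy
    · exact Finset.mem_insert_of_mem (hT.par_mem v hv hva)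
  · intro e
    rw [Finset.mem_insert, hT.mem_edges]
    constructor
    · rintro (rfl | ⟨v, hv, hva, rfl⟩)
      · exact ⟨x, Finset.mem_insert_self _ _, hxa, rfl⟩
      · exact ⟨v, Finset.mem_insert_of_mem hv, hva, rfl⟩
    · rintro ⟨v, hv, hva, rfl⟩
      rcases Finset.mem_insert.1 hv with rfl | hv
      · exact Or.inl rfl
      · exact Or.inr ⟨v, hv, hva, rfl⟩

omit [Fintype V] in
theorem isRootedSubtree_edge {t : SimpleGraph V} {a b : V} {par : V → V} {d : V → ℕ}
    (h : IsParent t a par d) (hab : t.Adj a b) :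
    IsRootedSubtree a par (PartialTree.edge a b) := by
  have hb : b ≠ a ∧ a = par b := by simpa using (h.adj a b).1 hab
  refine ⟨by simp [PartialTree.edge], ?_, ?_⟩
  · intro v hv hva
    obtain rfl : v = b := by simpa [PartialTree.edge, hva] using hv
    simp [PartialTree.edge, ← hb.2]
  · intro e
    simp only [PartialTree.edge, Finset.mem_singleton, Finset.mem_insert]
    constructor
    · rintro rfl
      exact ⟨b, Or.inr rfl, hb.1, by rw [← hb.2, Sym2.eq_swap]⟩
    · rintro ⟨v, rfl | rfl, hva, rfl⟩
      · exact absurd rfl hva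
      · rw [← hb.2, Sym2.eq_swap]

omit [DecidableEq V] [Fintype V] in
theorem IsRootedSubtree.fromEdgeSet_eq {t : SimpleGraph V} {a : V} {par : V → V} {d : V → ℕ}
    (h : IsParent t a par d) {T : PartialTree V} (hT : IsRootedSubtree a par T)
    (hv : ∀ v, v ∈ T.verts) : SimpleGraph.fromEdgeSet (T.edges : Set (Sym2 V)) = t := by
  ext u v
  rw [SimpleGraph.fromEdgeSet_adj, h.adj, Finset.mem_coe, hT.mem_edges]
  constructor
  · rintro ⟨⟨w, -, hw, he⟩, -⟩
    rcases Sym2.eq_iff.1 he with ⟨rfl, rfl⟩ | ⟨rfl, rfl⟩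
    · exact Or.inl ⟨hw, rfl⟩
    · exact Or.inr ⟨hw, rfl⟩
  · intro huv
    refine ⟨?_, ((h.adj u v).2 huv).ne⟩
    rcases huv with ⟨hu, rfl⟩ | ⟨hv', rfl⟩
    · exact ⟨u, hv u, hu, rfl⟩
    · exact ⟨v, hv v, hv', Sym2.eq_swap⟩

/-- A path without repetitions in `t` that stops on reaching a rooted subtree always steps from a
vertex to its parent: after a step from a parent to a child, it could never step to a parent
again, and the subtree is closed under taking parents. -/
theorem IsRootedSubtree.isChain_par {t : SimpleGraph V} {a : V} {par : V → V} {d : V → ℕ}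
    (h : IsParent t a par d) {T : PartialTree V} (hT : IsRootedSubtree a par T) {γ : List V}
    (hγ : IsExit T.vertsᶜ γ) (hnd : γ.Nodup) (ht : γ.IsChain t.Adj) :
    γ.IsChain fun u v => v = par u := by
  induction γ with
  | nil => exact hγ.elim
  | cons x r ih =>
    cases r with
    | nil => simp
    | cons y r =>
      obtain ⟨hx, hγ⟩ := hγ
      rw [List.nodup_cons] at hnd
      rw [List.isChain_cons_cons] at ht ⊢
      have ih := ih hγ hnd.2 ht.2
      refine ⟨?_, ih⟩
      rcases (h.adj x y).1 ht.1 with hxy | ⟨hya, hxy⟩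
      · exact hxy.2
      · exfalso
        cases r with
        | nil =>
          have hy : y ∈ T.verts := by simpa [IsExit] using hγ
          rw [hxy] at hx
          exact Finset.mem_compl.1 hx (hT.par_mem y hy hya)
        | cons z r =>
          rw [List.isChain_cons_cons] at ih
          exact hnd.1 (by simp [hxy, ih.1])

omit [DecidableEq V] [Fintype V] in
/-- Following parents from a given vertex until leaving `D` is deterministic. -/
theorem eq_of_isChain_par {par : V → V} {D : Finset V} {γ γ' : List V} (hγ : IsExit D γ)
    (hγ' : IsExit D γ') (h : γ.IsChain fun u v => v = par u)
    (h' : γ'.IsChain fun u v => v = par u) (hh : γ.head? = γ'.head?) : γ = γ' := by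
  induction γ generalizing γ' with
  | nil => exact hγ.elim
  | cons x r ih =>
    cases γ' with
    | nil => exact hγ'.elim
    | cons x' r' =>
      obtain rfl : x = x' := by simpa using hh
      cases r with
      | nil => rw [hγ'.eq_singleton hγ]
      | cons y r =>
        cases r' with
        | nil => rw [hγ.eq_singleton hγ']
        | cons y' r' =>
          rw [List.isChain_cons_cons] at h h'
          rw [ih hγ.2 hγ'.2 h.2 h'.2 (by simp [h.1, h'.1])]

omit [DecidableEq V] [Fintype V] in
theorem IsParent.exists_path {t : SimpleGraph V} {a : V} {par : V → V} {d : V → ℕ}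
    (h : IsParent t a par d) {D : Finset V} (ha : a ∉ D) (v : V) :
    ∃ γ, IsExit D γ ∧ γ.head? = some v ∧ γ.Nodup ∧ (γ.IsChain fun u v => v = par u) ∧
      ∀ u ∈ γ, d u ≤ d v := by
  induction hn : d v using Nat.strong_induction_on generalizing v with
  | _ n ih =>
    by_cases hv : v ∈ D
    · have hlt := h.lt v (by rintro rfl; exact ha hv)
      obtain ⟨γ, h1, h2, h3, h4, h5⟩ := ih _ (hn ▸ hlt) (par v) rfl
      refine ⟨v :: γ, (isExit_cons v h1.ne_nil).2 ⟨hv, h1⟩, rfl, ?_, ?_, ?_⟩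
      · refine List.nodup_cons.2 ⟨fun hm => ?_, h3⟩
        exact absurd (h5 v hm) (not_le.2 hlt)
      · rw [List.isChain_cons]
        exact ⟨fun y hy => by rw [h2] at hy; simpa using hy.symm, h4⟩
      · intro u hu
        rcases List.mem_cons.1 hu with rfl | hu
        · exact hn.le
        · exact (h5 u hu).trans (hn ▸ hlt.le)
    · exact ⟨[v], hv, rfl, by simp, by simp, by simp [hn]⟩

omit [DecidableEq V] [Fintype V] in
theorem IsParent.isChain_adj {t : SimpleGraph V} {a : V} {par : V → V} {d : V → ℕ}
    (h : IsParent t a par d) {D : Finset V} (ha : a ∉ D) {γ : List V} (hγ : IsExit D γ)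
    (hR : γ.IsChain fun u v => v = par u) : γ.IsChain t.Adj := by
  induction γ with
  | nil => simp
  | cons x r ih =>
    cases r with
    | nil => simp
    | cons y r =>
      rw [List.isChain_cons_cons] at hR ⊢
      refine ⟨(h.adj x y).2 (Or.inl ⟨?_, hR.1⟩), ih hγ.2 hR.2⟩
      rintro rfl
      exact ha hγ.1

/-- Along a path in `D` the weight collects the inverse degrees of the vertices of `D` it visits. -/
theorem wordWeight_mul_prod {G : SimpleGraph V} [DecidableRel G.Adj] {D : Finset V} {γ : List V}
    (hγ : IsExit D γ) (hnd : γ.Nodup) (hG : γ.IsChain G.Adj) :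
    wordWeight (srwStep G) γ * ∏ v ∈ D \ γ.toFinset, (G.degree v : ℝ≥0∞)⁻¹ =
      ∏ v ∈ D, (G.degree v : ℝ≥0∞)⁻¹ := by
  induction γ generalizing D with
  | nil => exact hγ.elim
  | cons x r ih =>
    cases r with
    | nil =>
      have : D \ [x].toFinset = D := by
        simpa [Finset.sdiff_singleton_eq_erase] using Finset.erase_eq_of_notMem hγ
      rw [this, wordWeight, one_mul]
    | cons y r =>
      obtain ⟨hx, hγ⟩ := hγ
      rw [List.nodup_cons] at hnd
      rw [List.isChain_cons_cons] at hG
      have hD : D \ (x :: y :: r).toFinset = D.erase x \ (y :: r).toFinset := by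
        ext v; simp; tauto
      rw [hD, wordWeight, mul_assoc, ih ((isExit_erase hnd.1).2 hγ) hnd.2 hG.2,
        ← Finset.mul_prod_erase D _ hx, srwStep, if_pos hG.1]

end Parent

/-! ### Uniform measures -/

theorem measurableSingletonClass_simpleGraph {V : Type*} [Finite V] :
    MeasurableSingletonClass (SimpleGraph V) := by
  refine ⟨fun t => ?_⟩
  have : ({t} : Set (SimpleGraph V)) = SimpleGraph.edgeSet ⁻¹' {t.edgeSet} := by
    ext u; simp
  rw [this]
  exact SimpleGraph.measurable_edgeSet (measurableSet_singleton _)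

/-- The common value `C` is not required to be `1 / |S|`, which follows from total mass `1`. -/
theorem eq_uniformOn_of_forall_singleton {α : Type*} [Finite α] [MeasurableSpace α]
    [MeasurableSingletonClass α] {ν : Measure α} [IsProbabilityMeasure ν] {S : Set α}
    (hS : ν Sᶜ = 0) {C : ℝ≥0∞} (hC : ∀ t ∈ S, ν {t} = C) : ν = uniformOn S := by
  have hfin : S.Finite := S.toFinite
  have h1 : C * Measure.count S = 1 := by
    have hS1 : ν S = 1 := (prob_compl_eq_zero_iff hfin.measurableSet).1 hS
    rw [← hS1, Measure.count_apply_finite S hfin]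
    conv_rhs => rw [← hfin.coe_toFinset]
    rw [← sum_measure_singleton, Finset.sum_congr rfl fun t ht => hC t (hfin.mem_toFinset.1 ht),
      Finset.sum_const, nsmul_eq_mul, mul_comm]
  refine Measure.ext_of_singleton fun t => ?_
  rw [uniformOn, cond_apply hfin.measurableSet]
  by_cases ht : t ∈ S
  · rw [hC t ht, Set.inter_eq_right.2 (Set.singleton_subset_iff.2 ht), Measure.count_singleton,
      mul_one]
    exact ENNReal.eq_inv_of_mul_eq_one_left h1
  · rw [Set.inter_singleton_eq_empty.2 ht, measure_empty, mul_zero]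
    exact measure_mono_null (Set.singleton_subset_iff.2 ht) hS

/-! ### The law of the output -/

section Law

variable {V : Type*} [Fintype V] [DecidableEq V] [MeasurableSpace V] [MeasurableSingletonClass V]
  {ι : Type*}

theorem measurableSet_joinRun (l : List ι) (T : PartialTree V) (Q : PartialTree V → Prop) :
    MeasurableSet {y : ι → ℕ → V | ∃ F, joinRun y l T = some F ∧ Q F} := by
  induction l generalizing T with
  | nil => simp [joinRun_nil_eq_some]
  | cons i l ih =>
    have : {y : ι → ℕ → V | ∃ F, joinRun y (i :: l) T = some F ∧ Q F} =
        ⋃ w : List V, ((fun y => y i) ⁻¹' {z : ℕ → V | exitWord T.vertsᶜ z = some w}) ∩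
          {y | ∃ F, joinRun y l (T.addPath (loopErasure w)) = some F ∧ Q F} := by
      ext y
      simp only [joinRun_cons_eq_some, Set.mem_ofPred_eq, Set.mem_iUnion, Set.mem_inter_iff,
        Set.mem_preimage]
      constructor
      · rintro ⟨F, ⟨w, h1, h2⟩, h3⟩
        exact ⟨w, h1, F, h2, h3⟩
      · rintro ⟨w, h1, F, h2, h3⟩
        exact ⟨F, ⟨w, h1, h2⟩, h3⟩
    rw [this]
    exact MeasurableSet.iUnion fun w =>
      ((measurable_pi_apply i) (measurableSet_exitWord_eq_some _ w)).inter (ih _)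

variable {Ω : Type*} [MeasurableSpace Ω] {μ : Measure Ω}

/-- Conditioning on the path of the first walk, which is independent of the later ones. -/
theorem measure_joinRun_cons {X : ι → ℕ → Ω → V} (hm : ∀ i t, Measurable (X i t))
    (hindep : iIndepFun (fun i ω t => X i t ω) μ) {i : ι} {l : List ι} (hi : i ∉ l)
    (T : PartialTree V) (Q : PartialTree V → Prop) :
    μ {ω | ∃ F, joinRun (fun j t => X j t ω) (i :: l) T = some F ∧ Q F} =
      ∑' w, μ {ω | exitWord T.vertsᶜ (fun t => X i t ω) = some w} *
        μ {ω | ∃ F, joinRun (fun j t => X j t ω) l (T.addPath (loopErasure w)) = some F ∧ Q F} := by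
  classical
  have hm' : ∀ i, Measurable fun ω t => X i t ω := fun i => measurable_pi_lambda _ (hm i)
  have hmall : Measurable fun ω i t => X i t ω := measurable_pi_lambda _ hm'
  have hind := hindep.indepFun_finset {i} l.toFinset (by simpa using hi) hm'
  have hset : {ω | ∃ F, joinRun (fun j t => X j t ω) (i :: l) T = some F ∧ Q F} =
      ⋃ w : List V, {ω | exitWord T.vertsᶜ (fun t => X i t ω) = some w} ∩
        {ω | ∃ F, joinRun (fun j t => X j t ω) l (T.addPath (loopErasure w)) = some F ∧ Q F} := by
    ext ω
    simp only [joinRun_cons_eq_some, Set.mem_ofPred_eq, Set.mem_iUnion, Set.mem_inter_iff]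
    constructor
    · rintro ⟨F, ⟨w, h1, h2⟩, h3⟩
      exact ⟨w, h1, F, h2, h3⟩
    · rintro ⟨w, h1, F, h2, h3⟩
      exact ⟨F, ⟨w, h1, h2⟩, h3⟩
  rw [hset, measure_iUnion]
  · refine tsum_congr fun w => ?_
    -- Independence concerns the family of trajectories with index in `l`. The run of the algorithm
    -- is a function of this family once it is extended arbitrarily to the other indices.
    let ext : (l.toFinset → ℕ → V) → (Ω → ι → ℕ → V) := fun z ω j =>
      if h : j ∈ l.toFinset then z ⟨j, h⟩ else fun t => X i t ω
    by_cases hΩ : Nonempty Ω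
    · obtain ⟨ω₀⟩ := hΩ
      have hext : Measurable fun z => ext z ω₀ := by
        refine measurable_pi_lambda _ fun j => ?_
        by_cases h : j ∈ l.toFinset
        · simpa only [ext, h, dif_pos] using measurable_pi_apply (⟨j, h⟩ : l.toFinset)
        · simp only [ext, h, dif_neg, not_false_eq_true]
          exact measurable_const
      have := hind.measure_inter_preimage_eq_mul
        ((fun z => z ⟨i, Finset.mem_singleton_self i⟩) ⁻¹'
          {z : ℕ → V | exitWord T.vertsᶜ z = some w})
        {z | ∃ F, joinRun (ext z ω₀) l (T.addPath (loopErasure w)) = some F ∧ Q F}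
        (measurable_pi_apply (⟨i, Finset.mem_singleton_self i⟩ : ({i} : Finset ι))
          (measurableSet_exitWord_eq_some _ w))
        (hext (measurableSet_joinRun l _ Q))
      have h2 : {ω | ∃ F, joinRun (fun j t => X j t ω) l (T.addPath (loopErasure w)) = some F ∧ Q F}
          = (fun ω (j : l.toFinset) t => X j t ω) ⁻¹'
            {z | ∃ F, joinRun (ext z ω₀) l (T.addPath (loopErasure w)) = some F ∧ Q F} := by
        ext ω
        simp only [Set.mem_ofPred_eq, Set.mem_preimage]
        rw [joinRun_congr (y := fun j t => X j t ω)]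
        intro j hj
        simp [ext, hj]
      rw [h2]
      exact this
    · have : μ = 0 := by
        rw [← Measure.measure_univ_eq_zero]
        rw [not_nonempty_iff] at hΩ
        rw [Set.univ_eq_empty_iff.2 hΩ, measure_empty]
      simp [this]
  · intro w w' hww
    refine Set.disjoint_left.2 fun ω h h' => hww ?_
    exact Option.some.inj (Eq.trans (Eq.symm h.1) h'.1)
  · exact fun w => (hm' i (measurableSet_exitWord_eq_some _ w)).inter
      (hmall (measurableSet_joinRun l _ Q))

/-- The probability of completing a rooted subtree `T` of `t` to `t`. The only way to do so is that
the loop-erased walk of each iteration is the path in `t` from the starting point to the current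
tree, and the probabilities of these loop-erased walks multiply up to a number that depends only
on the set of vertices outside `T`. -/
theorem measure_joinRun_eq [IsProbabilityMeasure μ] {G : SimpleGraph V} [DecidableRel G.Adj]
    (hdeg : ∀ v, 0 < G.degree v) {t : SimpleGraph V} (htG : t ≤ G) {a : V} {par : V → V}
    {d : V → ℕ} (h : IsParent t a par d) {start : ι → V} {X : ι → ℕ → Ω → V}
    (hX : ∀ i, IsSimpleRandomWalk G (start i) (X i) μ)
    (hindep : iIndepFun (fun i ω t => X i t ω) μ) {l : List ι} (hl : l.Nodup)
    {T : PartialTree V} (hT : IsRootedSubtree a par T)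
    (hcov : ∀ v, v ∉ T.verts → ∃ i ∈ l, start i = v)
    (hgreen : ∀ D ⊆ T.vertsᶜ, ∀ z ∈ D, ∀ y ∈ D, green (srwStep G) D y z ≠ ∞) :
    μ {ω | ∃ F, joinRun (fun i t => X i t ω) l T = some F ∧
        SimpleGraph.fromEdgeSet (F.edges : Set (Sym2 V)) = t} =
      greenDet (srwStep G) T.vertsᶜ * ∏ v ∈ T.vertsᶜ, (G.degree v : ℝ≥0∞)⁻¹ := by
  classical
  induction l generalizing T with
  | nil =>
    have hv : ∀ v, v ∈ T.verts := fun v => by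
      by_contra hv
      obtain ⟨i, hi, -⟩ := hcov v hv
      simp at hi
    have hD : T.vertsᶜ = ∅ := by ext v; simp [hv]
    simp [joinRun_nil_eq_some, hT.fromEdgeSet_eq h hv, hD, greenDet_empty]
  | cons i l ih =>
    rw [List.nodup_cons] at hl
    have ha : a ∉ T.vertsᶜ := by simpa using hT.root_mem
    obtain ⟨γ, hγ, hhead, hnd, hpar, -⟩ := h.exists_path ha (start i)
    have hcompl : (T.addPath γ).vertsᶜ = T.vertsᶜ \ γ.toFinset := by
      ext v; simp [PartialTree.addPath]
    have hK := ih hl.2 (T := T.addPath γ) (hT.addPath hγ hnd hpar) (by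
      intro v hv
      simp only [PartialTree.addPath, Finset.mem_union, List.mem_toFinset, not_or] at hv
      obtain ⟨j, hj, hjv⟩ := hcov v hv.1
      rcases List.mem_cons.1 hj with rfl | hj
      · exact absurd (List.mem_of_head? (hjv ▸ hhead)) hv.2
      · exact ⟨j, hj, hjv⟩) (by
      intro D hD
      rw [hcompl] at hD
      exact hgreen D (hD.trans Finset.sdiff_subset))
    rw [measure_joinRun_cons (fun i => (hX i).measurable) hindep hl.1]
    have hterm : ∀ w, μ {ω | exitWord T.vertsᶜ (fun t => X i t ω) = some w} *
        μ {ω | ∃ F, joinRun (fun j t => X j t ω) l (T.addPath (loopErasure w)) = some F ∧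
          SimpleGraph.fromEdgeSet (F.edges : Set (Sym2 V)) = t} =
        (if IsExit T.vertsᶜ w ∧ loopErasure w = γ then wordWeight (srwStep G) w else 0) *
          μ {ω | ∃ F, joinRun (fun j t => X j t ω) l (T.addPath γ) = some F ∧
          SimpleGraph.fromEdgeSet (F.edges : Set (Sym2 V)) = t} := by
      intro w
      rw [(hX i).measure_exitWord]
      by_cases hw : IsExit T.vertsᶜ w ∧ loopErasure w = γ
      · have hw' : w.head? = some (start i) := by
          rw [← head?_loopErasure, hw.2, hhead]
        rw [if_pos hw, if_pos ⟨hw.1, hw'⟩, hw.2]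
      · rw [if_neg hw, zero_mul]
        by_cases hw' : IsExit T.vertsᶜ w ∧ w.head? = some (start i)
        · refine mul_eq_zero_of_right _ ?_
          convert measure_empty (μ := μ)
          rw [Set.eq_empty_iff_forall_notMem]
          rintro ω ⟨F, hF, rfl⟩
          refine hw ⟨hw'.1, ?_⟩
          have hadj := isChain_adj_of_pathEdges_subset (nodup_loopErasure w)
            (Finset.subset_union_right.trans (joinRun_mono hF).2)
          refine eq_of_isChain_par hw'.1.loopErasure hγ ?_ hpar ?_
          · exact hT.isChain_par h hw'.1.loopErasure (nodup_loopErasure w) hadj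
          · rw [head?_loopErasure, hw'.2, hhead]
        · rw [if_neg hw', zero_mul]
    simp_rw [hterm]
    rw [ENNReal.tsum_mul_right, hK, hcompl]
    have h1 := exitSum_mul_greenDet (srwStep_ne_top hdeg) hgreen hγ hnd
    have h2 := wordWeight_mul_prod hγ hnd ((h.isChain_adj ha hγ hpar).imp fun _ _ h => htG h)
    have h3 : ∑' w, (if IsExit T.vertsᶜ w ∧ loopErasure w = γ
        then wordWeight (srwStep G) w else 0) = exitSum (srwStep G) T.vertsᶜ γ := by
      rw [exitSum]
    rw [h3, ← mul_assoc, h1, mul_assoc, h2]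

end Law

theorem mainTheorem2 {V : Type*} [Fintype V] [DecidableEq V]
    [MeasurableSpace V] [MeasurableSingletonClass V]
    (G : SimpleGraph V) [DecidableRel G.Adj] (hG : G.Connected)
    (a b : V) (hab : G.Adj a b)
    (order : List {x : V // x ≠ a ∧ x ≠ b})
    (horder : order.Nodup ∧ ∀ x, x ∈ order)
    {Ω : Type*} [MeasurableSpace Ω] (μ : Measure Ω) [IsProbabilityMeasure μ]
    (X : {x : V // x ≠ a ∧ x ≠ b} → ℕ → Ω → V)
    (hX : ∀ x, IsSimpleRandomWalk G x.1 (X x) μ)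
    (hindep : iIndepFun (fun x ω t => X x t ω) μ) :
    ∃ T : Ω → SimpleGraph V,
      (∀ᵐ ω ∂μ, wilsonSampling a b order (fun x t => X x t ω) = some (T ω)) ∧
      HasLaw T (uniformOn (spanningTreesThrough G a b)) μ := by
  classical
  have : Nontrivial V := ⟨a, b, hab.ne⟩
  have := measurableSingletonClass_simpleGraph (V := V)
  have hdeg : ∀ v, 0 < G.degree v := fun v => hG.preconnected.degree_pos_of_nontrivial v
  have hD0 : ∀ v, v ∈ (PartialTree.edge a b).vertsᶜ ↔ v ≠ a ∧ v ≠ b := by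
    intro v; simp [PartialTree.edge]
  have hgreen : ∀ D ⊆ (PartialTree.edge a b).vertsᶜ, ∀ z ∈ D, ∀ y ∈ D,
      green (srwStep G) D y z ≠ ∞ := by
    intro D hD z hz y hy
    have ha : a ∉ D := fun h => ((hD0 a).1 (hD h)).1 rfl
    obtain ⟨s, h1, h2⟩ := exists_isExit hG ha z
    refine green_ne_top _ h1 h2 ?_
    convert (((hX ⟨y, (hD0 y).1 (hD hy)⟩).tsum_exit_le_one D).trans_lt ENNReal.one_lt_top).ne
  -- almost surely the walks start where they should, step along edges, and reach `a` or `b`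
  have hgood : ∀ᵐ ω ∂μ, ∀ x, X x 0 ω = x.1 ∧
      (∀ n, ((List.range n).map fun t => X x t ω).IsChain G.Adj) ∧
      ∃ t, X x t ω ∈ (PartialTree.edge a b).verts := by
    rw [ae_all_iff]
    intro x
    filter_upwards [(hX x).start, (hX x).ae_isChain, (hX x).ae_exists_notMem
      (D := (PartialTree.edge a b).vertsᶜ)
      fun z hz => hgreen _ subset_rfl z hz x.1 ((hD0 x.1).2 x.2)] with ω h1 h2 h3
    exact ⟨h1, h2, by simpa using h3⟩
  -- the value `⊥` is taken only on the null event that the algorithm does not terminate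
  let T : Ω → SimpleGraph V := fun ω => (wilsonSampling a b order fun x t => X x t ω).getD ⊥
  have hT : ∀ᵐ ω ∂μ, ∃ F, joinRun (fun x t => X x t ω) order (PartialTree.edge a b) = some F ∧
      wilsonSampling a b order (fun x t => X x t ω) = some (T ω) ∧
      T ω = SimpleGraph.fromEdgeSet (F.edges : Set (Sym2 V)) ∧
      T ω ∈ spanningTreesThrough G a b := by
    filter_upwards [hgood] with ω hω
    obtain ⟨F, hF⟩ := exists_joinRun_eq_some (y := fun x t => X x t ω) order
      (T := PartialTree.edge a b) fun x => (hω x).2.2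
    have h1 : wilsonSampling a b order (fun x t => X x t ω) =
        some (SimpleGraph.fromEdgeSet (F.edges : Set (Sym2 V))) := by
      rw [wilsonSampling_eq, hF]; rfl
    have h2 : T ω = SimpleGraph.fromEdgeSet (F.edges : Set (Sym2 V)) := by
      simp only [T, h1, Option.getD_some]
    refine ⟨F, hF, by rw [h1, h2], h2, ?_⟩
    rw [h2]
    refine joinRun_mem_spanningTreesThrough hab (fun x => (hω x).2.1) ?_ hF
    intro v hva hvb
    exact ⟨⟨v, hva, hvb⟩, horder.2 _, (hω ⟨v, hva, hvb⟩).1⟩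
  have hmall : Measurable fun ω x t => X x t ω :=
    measurable_pi_lambda _ fun x => (hX x).measurable_trajectory
  have hTm : Measurable T := by
    refine measurable_to_countable' fun t => ?_
    have : T ⁻¹' {t} =
        {ω | ∃ F, joinRun (fun x t => X x t ω) order (PartialTree.edge a b) = some F ∧
          SimpleGraph.fromEdgeSet (F.edges : Set (Sym2 V)) = t} ∪
        ({ω | ∃ F, joinRun (fun x t => X x t ω) order (PartialTree.edge a b) = some F ∧
          True}ᶜ ∩ {_ω | ⊥ = t}) := by
      ext ω
      simp only [T, wilsonSampling_eq, Set.mem_preimage, Set.mem_singleton_iff, Set.mem_union,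
        Set.mem_inter_iff, Set.mem_compl_iff, Set.mem_ofPred_eq]
      cases joinRun (fun x t => X x t ω) order (PartialTree.edge a b) with
      | none => simp
      | some F => simp
    rw [this]
    exact (hmall (measurableSet_joinRun order _ _)).union
      ((hmall (measurableSet_joinRun order _ fun _ => True)).compl.inter (MeasurableSet.const _))
  refine ⟨T, hT.mono fun ω ⟨F, h⟩ => h.2.1, hTm.aemeasurable, ?_⟩
  have := Measure.isProbabilityMeasure_map (μ := μ) hTm.aemeasurable
  refine eq_uniformOn_of_forall_singleton (C := greenDet (srwStep G) (PartialTree.edge a b).vertsᶜ *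
    ∏ v ∈ (PartialTree.edge a b).vertsᶜ, (G.degree v : ℝ≥0∞)⁻¹) ?_ ?_
  · rw [Measure.map_apply hTm (Set.toFinite _).measurableSet]
    refine measure_mono_null ?_ hT
    rintro ω hω ⟨F, h⟩
    exact hω h.2.2.2
  · intro t ht
    obtain ⟨par, d, hpar⟩ := ht.2.1.exists_isParent a
    rw [Measure.map_apply hTm (measurableSet_singleton t), ← measure_joinRun_eq hdeg ht.1 hpar hX
      hindep horder.1 (isRootedSubtree_edge hpar ht.2.2) ?_ hgreen]
    · refine measure_congr (hT.mono fun ω ⟨F, h1, _, h3, _⟩ => ?_)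
      refine propext ⟨fun h => ⟨F, h1, h3.symm.trans h⟩, ?_⟩
      rintro ⟨F', h1', h2'⟩
      obtain rfl := Option.some.inj (h1.symm.trans h1')
      exact h3.trans h2'
    · intro v hv
      exact ⟨⟨v, (hD0 v).1 (by simpa using hv)⟩, horder.2 _, rfl⟩
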